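/- Let $\Sigma$ be a finite alphabet and $R$ an arbitrary set of weights. **Logic.** First-order formulas are $\varphi ::= \top \mid P_a(x) \mid x\le y \mid \neg\varphi \mid \varphi\wedge\varphi \mid \forall x\,\varphi$, with $a\in\Sigma$ and first-order variables $x,y$ ranging over the positions of a nonempty word. Step formulas are $\Psi ::= r \mid \varphi\,?\,\Psi:\Psi$ with $r\in R$, and wFO formulas are $\Phi ::= \mathbf 0 \mid \prod_x\Psi \mid \varphi\,?\,\Phi:\Phi \mid \Phi+\Phi \mid \sum_x\Phi$. For a word $u\in\Sigma^+$ and a valuation $\sigma$ of the variables by positions of $u$, the semantics of a step formula is a weight: $[\![r]\!](u,\sigma)=r$, and $[\![\varphi\,?\,\Psi_1:\Psi_2]\!](u,\sigma)$ is $[\![\Psi_1]\!](u,\sigma)$ if $u,\sigma\models\varphi$ and $[\![\Psi_2]\!](u,\sigma)$ otherwise. The abstract semantics of a wFO formula is a finite multiset of weight sequences: $[\![\mathbf 0]\!](u,\sigma)=\emptyset$; $[\![\prod_x\Psi]\!](u,\sigma)$ is the singleton multiset containing $r_1\cdots r_{|u|}$ with $r_i=[\![\Psi]\!](u,\sigma[x\mapsto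 i])$; $\varphi\,?\,\Phi_1:\Phi_2$ is interpreted as for step formulas; $+$ is the multiset union $\uplus$; and $[\![\sum_x\Phi]\!](u,\sigma)=\biguplus_{1\le i\le|u|}[\![\Phi]\!](u,\sigma[x\mapsto i])$. If $\Phi$ is a sentence (has no free variables), $\sigma$ is irrelevant and we write $[\![\Phi]\!](u)$. **Automata.** A weighted automaton $\mathcal A=(Q,\Sigma,\Delta,\mathrm{wgt},I,F)$ consists of a finite set $Q$ of states, a set $\Delta\subseteq Q\times\Sigma\times Q$ of transitions, a map $\mathrm{wgt}:\Delta\to R$, and sets $I,F\subseteq Q$ of initial and final states. Its abstract semantics $[\![\mathcal A]\!]$ maps $u\in\Sigma^+$ to the multiset of the weight sequences of all runs from a state of $I$ to a state of $F$ with label $u$. Let $L_{p,q}$ be the set of labels of runs from $p$ to $q$. The automaton $\mathcal A$ is - *aperiodic* if there is $m\ge1$ such that $u^m\in L_{p,q}\iff u^{m+1}\in L_{p,q}$ for all states $p,q$ and all $u\in\Sigma^+$; - *unambiguous* if every $u\in\Sigma^+$ labels at most one run from a state of $I$ to a state of $F$; - *SCC-unambiguous* if, for all states $p,q$ in the same strongly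 connected component (that is, $p=q$, or there are runs from $p$ to $q$ and from $q$ to $p$), every $u\in\Sigma^+$ labels at most one run from $p$ to $q$. **Theorem.** Let $\Phi$ be a wFO sentence over $\Sigma$ and $R$. 1. There is an aperiodic SCC-unambiguous weighted automaton $\mathcal A$ with $[\![\mathcal A]\!]=[\![\Phi]\!]$. 2. If $\Phi$ contains neither $+$ nor any $\sum_x$, then $\mathcal A$ in (1) can moreover be chosen unambiguous. 3. If $\Phi$ contains no $\sum_x$, then $\mathcal A$ in (1) can be chosen as the disjoint union of finitely many aperiodic unambiguous weighted automata. -/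

import Mathlib

/-! ### Words -/

/-- `Σ⁺`: the nonempty finite words over `A`. -/
abbrev PWord (A : Type*) := {u : List A // u ≠ []}

/-- The power `u ^ m` of a word. -/
def wordPow {A : Type*} (u : List A) (m : ℕ) : List A := (List.replicate m u).flatten

/-! ### Weighted automata -/

/-- An `R`-weighted automaton over `A`: a finite nondeterministic automaton with sets of initial
and of final states, and a weight for every transition. -/
structure WAut (A R : Type*) where
  Q : Type
  finite_Q : Finite Q
  Δ : Set (Q × A × Q)
  wgt : Δ → R
  I : Set Q
  F : Set Q

namespace WAut

variable {A R : Type*}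

instance (𝒜 : WAut A R) : Finite 𝒜.Q := 𝒜.finite_Q

/-- `𝒜.IsRun p q ρ`: the sequence `ρ` of transitions is a run from `p` to `q`; the empty sequence
is the empty run from `p` to `p`. -/
def IsRun (𝒜 : WAut A R) : 𝒜.Q → 𝒜.Q → List 𝒜.Δ → Prop
  | p, q, [] => p = q
  | p, q, δ :: ρ => δ.1.1 = p ∧ 𝒜.IsRun δ.1.2.2 q ρ

/-- The word read by a sequence of transitions. -/
def label (𝒜 : WAut A R) (ρ : List 𝒜.Δ) : List A := ρ.map fun δ => δ.1.2.1

/-- The weight sequence of a sequence of transitions. -/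
def weightSeq (𝒜 : WAut A R) (ρ : List 𝒜.Δ) : List R := ρ.map 𝒜.wgt

/-- The runs from `p` to `q` with label `u`. -/
def runs (𝒜 : WAut A R) (p q : 𝒜.Q) (u : List A) : Set (List 𝒜.Δ) :=
  {ρ | 𝒜.IsRun p q ρ ∧ 𝒜.label ρ = u}

/-- The language `L(𝒜_{p,q})` of the labels of runs from `p` to `q`. -/
def lang (𝒜 : WAut A R) (p q : 𝒜.Q) : Set (List A) := {u | (𝒜.runs p q u).Nonempty}

theorem finite_runs [Finite A] (𝒜 : WAut A R) (p q : 𝒜.Q) (u : List A) :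
    (𝒜.runs p q u).Finite := by
  refine (List.finite_length_eq 𝒜.Δ u.length).subset ?_
  rintro ρ ⟨-, h⟩
  simp [← h, label]

/-- The abstract semantics from `p` to `q`: the multiset of the weight sequences of the runs from
`p` to `q` with label `u`, each run counted once. -/
noncomputable def usemFrom [Finite A] (𝒜 : WAut A R) (p q : 𝒜.Q) (u : PWord A) :
    Multiset (List R) :=
  (𝒜.finite_runs p q u.1).toFinset.val.map 𝒜.weightSeq

/-- The abstract semantics: the multiset union over all `p ∈ I` and `q ∈ F` of the semantics from
`p` to `q`. -/
noncomputable def usem [Finite A] (𝒜 : WAut A R) (u : PWord A) : Multiset (List R) :=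
  ∑ p ∈ (Set.toFinite 𝒜.I).toFinset, ∑ q ∈ (Set.toFinite 𝒜.F).toFinset, 𝒜.usemFrom p q u

/-- Aperiodicity of the underlying nondeterministic automaton. -/
def Aperiodic (𝒜 : WAut A R) : Prop :=
  ∃ m : ℕ, 1 ≤ m ∧ ∀ (p q : 𝒜.Q) (u : List A), u ≠ [] →
    (wordPow u m ∈ 𝒜.lang p q ↔ wordPow u (m + 1) ∈ 𝒜.lang p q)

/-- Every nonempty word has at most one successful run. -/
def Unambiguous (𝒜 : WAut A R) : Prop :=
  ∀ u : List A, u ≠ [] → {ρ | ∃ p ∈ 𝒜.I, ∃ q ∈ 𝒜.F, ρ ∈ 𝒜.runs p q u}.Subsingleton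

/-- Every nonempty word labels at most one run from `p` to `q`. -/
def UnambiguousFrom (𝒜 : WAut A R) (p q : 𝒜.Q) : Prop :=
  ∀ u : List A, u ≠ [] → (𝒜.runs p q u).Subsingleton

/-- `p` and `q` are in the same strongly connected component. -/
def SameSCC (𝒜 : WAut A R) (p q : 𝒜.Q) : Prop :=
  p = q ∨ ((∃ u ∈ 𝒜.lang p q, u ≠ []) ∧ (∃ u ∈ 𝒜.lang q p, u ≠ []))

/-- `𝒜` is unambiguous on each strongly connected component. -/
def SCCUnambiguous (𝒜 : WAut A R) : Prop :=
  ∀ p q : 𝒜.Q, 𝒜.SameSCC p q → 𝒜.UnambiguousFrom p q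

/-- The disjoint union of a finite family of weighted automata: its states are the pairs `⟨i, p⟩`
with `p` a state of `ℬ i`, and its transitions are those of the `ℬ i`, with their weights. -/
def iUnion {n : ℕ} (ℬ : Fin n → WAut A R) : WAut A R where
  Q := Σ i, (ℬ i).Q
  finite_Q := inferInstance
  Δ := {t | ∃ h : t.1.1 = t.2.2.1, (h ▸ t.1.2, t.2.1, t.2.2.2) ∈ (ℬ t.2.2.1).Δ}
  wgt t := (ℬ t.1.2.2.1).wgt ⟨_, t.2.2⟩
  I := {s | s.2 ∈ (ℬ s.1).I}
  F := {s | s.2 ∈ (ℬ s.1).F}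

theorem mem_iUnion_Δ {n : ℕ} (ℬ : Fin n → WAut A R) (t : (iUnion ℬ).Q × A × (iUnion ℬ).Q) :
    t ∈ (iUnion ℬ).Δ ↔ ∃ (i : Fin n) (p q : (ℬ i).Q) (a : A),
      (p, a, q) ∈ (ℬ i).Δ ∧ t = (⟨i, p⟩, a, ⟨i, q⟩) := by
  constructor
  · obtain ⟨⟨i, p⟩, a, ⟨j, q⟩⟩ := t
    rintro ⟨h, ht⟩
    dsimp only at h
    subst h
    exact ⟨i, p, q, a, ht, rfl⟩
  · rintro ⟨i, p, q, a, h, rfl⟩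
    exact ⟨rfl, h⟩

theorem wgt_iUnion {n : ℕ} (ℬ : Fin n → WAut A R) (i : Fin n) (p q : (ℬ i).Q) (a : A)
    (h : (p, a, q) ∈ (ℬ i).Δ) (h' : (⟨i, p⟩, a, ⟨i, q⟩) ∈ (iUnion ℬ).Δ) :
    (iUnion ℬ).wgt ⟨_, h'⟩ = (ℬ i).wgt ⟨(p, a, q), h⟩ := rfl

end WAut

/-! ### First-order logic on words; variables are natural numbers -/

/-- `φ ::= ⊤ | P_a(x) | x ≤ y | ¬φ | φ ∧ φ | ∀x φ` -/
inductive FO (A : Type*) where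
  | top : FO A
  | letter (a : A) (x : ℕ) : FO A
  | le (x y : ℕ) : FO A
  | not (φ : FO A) : FO A
  | and (φ ψ : FO A) : FO A
  | all (x : ℕ) (φ : FO A) : FO A

namespace FO

variable {A : Type*}

/-- The free variables of a formula. -/
def fv : FO A → Finset ℕ
  | top => ∅
  | letter _ x => {x}
  | le x y => {x, y}
  | not φ => φ.fv
  | and φ ψ => φ.fv ∪ ψ.fv
  | all x φ => φ.fv \ {x}

/-- `u, σ ⊨ φ`. The positions of `u` are the elements of `Fin u.length`. -/
def Sat (u : List A) : (ℕ → Fin u.length) → FO A → Prop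
  | _, top => True
  | σ, letter a x => u.get (σ x) = a
  | σ, le x y => σ x ≤ σ y
  | σ, not φ => ¬ Sat u σ φ
  | σ, and φ ψ => Sat u σ φ ∧ Sat u σ ψ
  | σ, all x φ => ∀ i : Fin u.length, Sat u (Function.update σ x i) φ

theorem sat_congr (u : List A) (φ : FO A) (σ τ : ℕ → Fin u.length)
    (h : ∀ x ∈ φ.fv, σ x = τ x) : Sat u σ φ ↔ Sat u τ φ := by
  induction φ generalizing σ τ with
  | top => rfl
  | letter a x => simp [Sat, h x (by simp [fv])]
  | le x y => simp [Sat, h x (by simp [fv]), h y (by simp [fv])]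
  | not φ ih => exact not_congr (ih σ τ h)
  | and φ ψ ih₁ ih₂ =>
    exact and_congr (ih₁ σ τ fun x hx => h x (by simp [fv, hx]))
      (ih₂ σ τ fun x hx => h x (by simp [fv, hx]))
  | all x φ ih =>
    refine forall_congr' fun i => ih _ _ fun y hy => ?_
    by_cases hxy : y = x
    · subst hxy; simp
    · simp [hxy, h y (by simp [fv, hy, hxy])]

end FO

/-! ### Weighted first-order logic -/

/-- `Ψ ::= r | φ ? Ψ : Ψ` -/
inductive StepWFO (A R : Type*) where
  | const (r : R) : StepWFO A R
  | ite (φ : FO A) (Ψ₁ Ψ₂ : StepWFO A R) : StepWFO A R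

namespace StepWFO

variable {A R : Type*}

/-- The free variables of a step formula. -/
def fv : StepWFO A R → Finset ℕ
  | const _ => ∅
  | ite φ Ψ₁ Ψ₂ => φ.fv ∪ Ψ₁.fv ∪ Ψ₂.fv

open Classical in
/-- The semantics of a step formula, a single weight. -/
noncomputable def sem (u : List A) (σ : ℕ → Fin u.length) : StepWFO A R → R
  | const r => r
  | ite φ Ψ₁ Ψ₂ => if φ.Sat u σ then Ψ₁.sem u σ else Ψ₂.sem u σ

theorem sem_congr (u : List A) (Ψ : StepWFO A R) (σ τ : ℕ → Fin u.length)
    (h : ∀ x ∈ Ψ.fv, σ x = τ x) : Ψ.sem u σ = Ψ.sem u τ := by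
  induction Ψ with
  | const r => rfl
  | ite φ Ψ₁ Ψ₂ ih₁ ih₂ =>
    classical
    exact if_congr (FO.sat_congr u φ σ τ fun x hx => h x (by simp [fv, hx]))
      (ih₁ fun x hx => h x (by simp [fv, hx])) (ih₂ fun x hx => h x (by simp [fv, hx]))

end StepWFO

/-- `Φ ::= 0 | ∏_x Ψ | φ ? Φ : Φ | Φ + Φ | ∑_x Φ` -/
inductive WFO (A R : Type*) where
  | zero : WFO A R
  | prod (x : ℕ) (Ψ : StepWFO A R) : WFO A R
  | ite (φ : FO A) (Φ₁ Φ₂ : WFO A R) : WFO A R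
  | add (Φ₁ Φ₂ : WFO A R) : WFO A R
  | sum (x : ℕ) (Φ : WFO A R) : WFO A R

namespace WFO

variable {A R : Type*}

/-- The free variables of a weighted formula. -/
def fv : WFO A R → Finset ℕ
  | zero => ∅
  | prod x Ψ => Ψ.fv \ {x}
  | ite φ Φ₁ Φ₂ => φ.fv ∪ Φ₁.fv ∪ Φ₂.fv
  | add Φ₁ Φ₂ => Φ₁.fv ∪ Φ₂.fv
  | sum x Φ => Φ.fv \ {x}

def IsSentence (Φ : WFO A R) : Prop := Φ.fv = ∅

/-- `Φ` does not contain the binary sum `+`. -/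
def PlusFree : WFO A R → Prop
  | zero => True
  | prod _ _ => True
  | ite _ Φ₁ Φ₂ => Φ₁.PlusFree ∧ Φ₂.PlusFree
  | add _ _ => False
  | sum _ Φ => Φ.PlusFree

/-- `Φ` does not contain the first-order sum `∑_x`. -/
def SumFree : WFO A R → Prop
  | zero => True
  | prod _ _ => True
  | ite _ Φ₁ Φ₂ => Φ₁.SumFree ∧ Φ₂.SumFree
  | add Φ₁ Φ₂ => Φ₁.SumFree ∧ Φ₂.SumFree
  | sum _ _ => False

open Classical in
/-- The semantics of a weighted formula on a word with a valuation. -/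
noncomputable def sem (u : List A) : (ℕ → Fin u.length) → WFO A R → Multiset (List R)
  | _, zero => 0
  | σ, prod x Ψ => {List.ofFn fun i : Fin u.length => Ψ.sem u (Function.update σ x i)}
  | σ, ite φ Φ₁ Φ₂ => if φ.Sat u σ then sem u σ Φ₁ else sem u σ Φ₂
  | σ, add Φ₁ Φ₂ => sem u σ Φ₁ + sem u σ Φ₂
  | σ, sum x Φ => ∑ i : Fin u.length, sem u (Function.update σ x i) Φ

theorem sem_congr (u : List A) (Φ : WFO A R) (σ τ : ℕ → Fin u.length)
    (h : ∀ x ∈ Φ.fv, σ x = τ x) : sem u σ Φ = sem u τ Φ := by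
  induction Φ generalizing σ τ with
  | zero => rfl
  | prod x Ψ =>
    simp only [sem]
    congr 2
    funext i
    refine Ψ.sem_congr u _ _ fun y hy => ?_
    by_cases hxy : y = x
    · subst hxy; simp
    · simp [hxy, h y (by simp [fv, hy, hxy])]
  | ite φ Φ₁ Φ₂ ih₁ ih₂ =>
    classical
    exact if_congr (FO.sat_congr u φ σ τ fun x hx => h x (by simp [fv, hx]))
      (ih₁ σ τ fun x hx => h x (by simp [fv, hx])) (ih₂ σ τ fun x hx => h x (by simp [fv, hx]))
  | add Φ₁ Φ₂ ih₁ ih₂ =>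
    simp only [sem, ih₁ σ τ fun x hx => h x (by simp [fv, hx]),
      ih₂ σ τ fun x hx => h x (by simp [fv, hx])]
  | sum x Φ ih =>
    refine Finset.sum_congr rfl fun i _ => ih _ _ fun y hy => ?_
    by_cases hxy : y = x
    · subst hxy; simp
    · simp [hxy, h y (by simp [fv, hy, hxy])]

/-- The abstract semantics of a sentence. The valuation is irrelevant for a sentence (see
`usem_eq`); the one that maps all variables to the first position is used. -/
noncomputable def usem (Φ : WFO A R) (u : PWord A) : Multiset (List R) :=
  sem u.1 (fun _ => ⟨0, List.length_pos_of_ne_nil u.2⟩) Φ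

theorem usem_eq {Φ : WFO A R} (hΦ : Φ.IsSentence) (u : PWord A) (σ : ℕ → Fin u.1.length) :
    Φ.usem u = sem u.1 σ Φ :=
  sem_congr _ _ _ _ fun x hx => by
    rw [IsSentence] at hΦ
    simp [hΦ] at hx

end WFO

/-! Encode a word with a valuation as the word `enc u σ` whose letters carry the variables placed
there. First-order properties of such words are recognized by finite aperiodic monoids
(`FO.isRec_sat`). The essential case is quantification over a position, where `Block` records the
contexts in which a factor contains a witness; it stays aperiodic because a witness inside a long
power has many copies of the base on one of its two sides. Consequently the weight that a step
formula assigns to a position depends only on the letter there and on the monoid values of the parts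
to its left and right.

Case distinctions become guards and sums move outwards, so every formula is a finite sum of guarded
products below `k` position sums (`Monomial.exists_list_sem_eq`). The terms of such a monomial are
indexed by the valuations that satisfy the guard.

The automaton `markAut` guesses the valuation by marking letters. Its states hold the value already
read, computed forwards, and the value still to be read, verified backwards. Thus the endpoints and
the marked word determine a run, and successful runs correspond to the valuations satisfying the
guard (`markAut.mem_successful`). The set of used variables only grows, so inside a strongly
connected component nothing is marked and the label determines the run. A long power of a word must
contain a long unmarked stretch, which can be pumped by aperiodicity of the monoid. Without position
sums, the only variable left is pinned to the first position, so at most one run succeeds. Disjoint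
unions realize the remaining finite sums. -/

/-! ### Finite aperiodic monoids as recognizers -/

/-- A map from letters to a finite aperiodic monoid. -/
structure Recognizer (B : Type*) where
  M : Type
  [monoid : Monoid M]
  [finite : Finite M]
  hom : B → M
  aper : ∃ N : ℕ, ∀ x : M, x ^ (N + 1) = x ^ N

namespace Recognizer

variable {B B' T T₁ T₂ : Type*}

attribute [instance] Recognizer.monoid Recognizer.finite

/-- The value of a word in the monoid. -/
def ev (𝓡 : Recognizer B) (v : List B) : 𝓡.M := (v.map 𝓡.hom).prod

@[simp] theorem ev_nil (𝓡 : Recognizer B) : 𝓡.ev [] = 1 := rfl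

@[simp] theorem ev_cons (𝓡 : Recognizer B) (b : B) (v : List B) :
    𝓡.ev (b :: v) = 𝓡.hom b * 𝓡.ev v := by simp [ev]

@[simp] theorem ev_append (𝓡 : Recognizer B) (v w : List B) :
    𝓡.ev (v ++ w) = 𝓡.ev v * 𝓡.ev w := by simp [ev]

theorem pow_succ_eq_of_le {M : Type*} [Monoid M] {N n : ℕ} {x : M}
    (h : x ^ (N + 1) = x ^ N) (hn : N ≤ n) : x ^ (n + 1) = x ^ n := by
  obtain ⟨d, rfl⟩ := Nat.exists_eq_add_of_le hn
  rw [show N + d + 1 = (N + 1) + d by ring, pow_add, h, pow_add]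

/-- `F` only depends on the value of the word. -/
def Rec (𝓡 : Recognizer B) (F : List B → T) : Prop :=
  ∀ v w, 𝓡.ev v = 𝓡.ev w → F v = F w

/-- `G`, a function of a word with a distinguished position, only depends on the letter at that
position and on the values of the parts to its left and to its right. -/
def PRec (𝓡 : Recognizer B) (G : List B → B → List B → T) : Prop :=
  ∀ l l' b r r', 𝓡.ev l = 𝓡.ev l' → 𝓡.ev r = 𝓡.ev r' → G l b r = G l' b r'

/-- The trivial recognizer. -/
def triv (B : Type*) : Recognizer B where
  M := Unit
  hom _ := 1
  aper := ⟨0, fun _ => rfl⟩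

/-- The product of two recognizers. -/
def prod (𝓡 𝓢 : Recognizer B) : Recognizer B where
  M := 𝓡.M × 𝓢.M
  hom b := (𝓡.hom b, 𝓢.hom b)
  aper := by
    obtain ⟨N, hN⟩ := 𝓡.aper
    obtain ⟨N', hN'⟩ := 𝓢.aper
    refine ⟨max N N', fun x => Prod.ext ?_ ?_⟩
    · exact pow_succ_eq_of_le (hN x.1) (le_max_left _ _)
    · exact pow_succ_eq_of_le (hN' x.2) (le_max_right _ _)

theorem ev_prod (𝓡 𝓢 : Recognizer B) (v : List B) : (𝓡.prod 𝓢).ev v = (𝓡.ev v, 𝓢.ev v) := by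
  induction v with
  | nil => rfl
  | cons b v ih => rw [ev_cons, ih, ev_cons, ev_cons]; rfl

theorem ev_prod_eq {𝓡 𝓢 : Recognizer B} {v w : List B} :
    (𝓡.prod 𝓢).ev v = (𝓡.prod 𝓢).ev w ↔ 𝓡.ev v = 𝓡.ev w ∧ 𝓢.ev v = 𝓢.ev w := by
  rw [ev_prod, ev_prod]
  exact Prod.mk_inj

/-- Precomposition with a map of letters. -/
def comap (𝓡 : Recognizer B) (c : B' → B) : Recognizer B' where
  M := 𝓡.M
  hom b := 𝓡.hom (c b)
  aper := 𝓡.aper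

theorem ev_comap (𝓡 : Recognizer B) (c : B' → B) (v : List B') :
    (𝓡.comap c).ev v = 𝓡.ev (v.map c) := by
  simp only [ev, List.map_map]
  rfl

/-- The monoid that recognizes existential quantification over a position: an element consists of
an element of `M` and a set of contexts in which a witness exists. -/
@[ext]
structure Block (M : Type) where
  val : M
  ctx : Set (M × M)

namespace Block

variable {M : Type} [Monoid M]

/-- A witness for a product lies in the left or in the right factor; the value of the other factor
then joins the context on its side. -/
instance : Mul (Block M) :=
  ⟨fun a b => ⟨a.val * b.val, {c | (c.1, b.val * c.2) ∈ a.ctx ∨ (c.1 * a.val, c.2) ∈ b.ctx}⟩⟩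

instance : One (Block M) := ⟨⟨1, ∅⟩⟩

theorem mul_val (a b : Block M) : (a * b).val = a.val * b.val := rfl

theorem mem_mul_ctx (a b : Block M) (x y : M) :
    (x, y) ∈ (a * b).ctx ↔ (x, b.val * y) ∈ a.ctx ∨ (x * a.val, y) ∈ b.ctx := Iff.rfl

theorem one_val : (1 : Block M).val = 1 := rfl

theorem one_ctx : (1 : Block M).ctx = ∅ := rfl

instance : Monoid (Block M) where
  mul_assoc a b c := by
    ext ⟨x, y⟩
    · simp [mul_val, mul_assoc]
    · simp [mul_val, mem_mul_ctx, mul_assoc, or_assoc]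
  one_mul a := by
    ext ⟨x, y⟩
    · simp [mul_val, one_val]
    · simp [mem_mul_ctx, one_val, one_ctx]
  mul_one a := by
    ext ⟨x, y⟩
    · simp [mul_val, one_val]
    · simp [mem_mul_ctx, one_val, one_ctx]

instance [Finite M] : Finite (Block M) :=
  Finite.of_injective (fun a : Block M => (a.val, a.ctx)) fun a b h => by
    cases a; cases b; simpa using h

theorem pow_val (a : Block M) (n : ℕ) : (a ^ n).val = a.val ^ n := by
  induction n with
  | zero => simp [one_val]
  | succ n ih => rw [pow_succ, mul_val, ih, pow_succ]

/-- The witness lies in one of the `n` copies, with `i` copies before it and `j` after it. -/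
theorem mem_pow_ctx (a : Block M) (n : ℕ) (x y : M) :
    (x, y) ∈ (a ^ n).ctx ↔ ∃ i j, i + j + 1 = n ∧ (x * a.val ^ i, a.val ^ j * y) ∈ a.ctx := by
  induction n generalizing y with
  | zero => simp [one_ctx]
  | succ n ih =>
    rw [pow_succ, mem_mul_ctx, ih, pow_val]
    constructor
    · rintro (⟨i, j, h, hm⟩ | h)
      · exact ⟨i, j + 1, by omega, by rwa [pow_succ, mul_assoc]⟩
      · exact ⟨n, 0, rfl, by simpa using h⟩
    · rintro ⟨i, j, h, hm⟩
      rcases j with _ | j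
      · obtain rfl : i = n := by omega
        exact Or.inr (by simpa using hm)
      · exact Or.inl ⟨i, j, by omega, by rwa [← mul_assoc, ← pow_succ]⟩

theorem aper (h : ∃ N : ℕ, ∀ x : M, x ^ (N + 1) = x ^ N) :
    ∃ N : ℕ, ∀ a : Block M, a ^ (N + 1) = a ^ N := by
  obtain ⟨N, hN⟩ := h
  have key {n : ℕ} (x : M) (hn : N ≤ n) : x ^ (n + 1) = x ^ n := pow_succ_eq_of_le (hN x) hn
  -- Around a witness in a power with exponent `2 * N + 2` there are `2 * N + 1` other copies, so
  -- one side has at least `N + 1` and can lose one. With exponent `2 * N + 1`, one side has at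
  -- least `N` and can gain one.
  refine ⟨2 * N + 1, fun a => ?_⟩
  ext ⟨x, y⟩
  · rw [pow_val, pow_val, key _ (by omega)]
  · rw [mem_pow_ctx, mem_pow_ctx]
    constructor
    · rintro ⟨i, j, h, hm⟩
      rcases le_or_gt (N + 1) i with hi | hi
      · obtain ⟨i, rfl⟩ : ∃ i', i = i' + 1 := ⟨i - 1, by omega⟩
        exact ⟨i, j, by omega, by rwa [key _ (by omega)] at hm⟩
      · obtain ⟨j, rfl⟩ : ∃ j', j = j' + 1 := ⟨j - 1, by omega⟩
        exact ⟨i, j, by omega, by rwa [key (n := j) _ (by omega)] at hm⟩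
    · rintro ⟨i, j, h, hm⟩
      rcases le_or_gt N i with hi | hi
      · exact ⟨i + 1, j, by omega, by rwa [key _ hi]⟩
      · exact ⟨i, j + 1, by omega, by rwa [key (n := j) _ (by omega)]⟩

end Block

/-- The recognizer for existential quantification over a position. -/
def block (𝓡 : Recognizer B) (G : List B → B → List B → Prop) : Recognizer B where
  M := Block 𝓡.M
  hom b := ⟨𝓡.hom b, {c | ∃ l r, 𝓡.ev l = c.1 ∧ 𝓡.ev r = c.2 ∧ G l b r}⟩
  aper := Block.aper 𝓡.aper

theorem ev_block_val (𝓡 : Recognizer B) (G : List B → B → List B → Prop) (v : List B) :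
    ((𝓡.block G).ev v).val = 𝓡.ev v := by
  induction v with
  | nil => rfl
  | cons b v ih => rw [ev_cons, ev_cons, ← ih]; rfl

/-- The left context `l₀` is kept general because the induction moves each letter read into it. The
contexts stored for a letter come from arbitrary words with the right values; `hG` exchanges these
for the actual ones. -/
theorem mem_ev_block_ctx {𝓡 : Recognizer B} {G : List B → B → List B → Prop} (hG : 𝓡.PRec G)
    (l₀ v r₀ : List B) :
    (𝓡.ev l₀, 𝓡.ev r₀) ∈ ((𝓡.block G).ev v).ctx ↔
      ∃ l b r, v = l ++ b :: r ∧ G (l₀ ++ l) b (r ++ r₀) := by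
  induction v generalizing l₀ with
  | nil =>
    simp only [ev_nil]
    exact ⟨fun h => h.elim, by simp⟩
  | cons c v ih =>
    have h1 : (𝓡.ev l₀, 𝓡.ev r₀) ∈ ((𝓡.block G).ev (c :: v)).ctx ↔
        (∃ l r, 𝓡.ev l = 𝓡.ev l₀ ∧ 𝓡.ev r = 𝓡.ev (v ++ r₀) ∧ G l c r) ∨
        (𝓡.ev (l₀ ++ [c]), 𝓡.ev r₀) ∈ ((𝓡.block G).ev v).ctx := by
      rw [ev_cons]
      refine (Block.mem_mul_ctx _ _ _ _).trans (or_congr ?_ ?_)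
      · rw [ev_block_val, ev_append]; rfl
      · rw [ev_append, ev_cons, ev_nil, mul_one]; rfl
    rw [h1, ih]
    constructor
    · rintro (⟨l, r, hl, hr, h⟩ | ⟨l, b, r, rfl, h⟩)
      · exact ⟨[], c, v, rfl, by rwa [hG _ (l₀ ++ []) _ _ (v ++ r₀) (by simpa using hl) hr] at h⟩
      · exact ⟨c :: l, b, r, rfl, by simpa using h⟩
    · rintro ⟨l, b, r, hv, h⟩
      rcases l with _ | ⟨d, l⟩
      · simp only [List.nil_append, List.cons.injEq] at hv
        obtain ⟨rfl, rfl⟩ := hv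
        exact Or.inl ⟨l₀, v ++ r₀, rfl, rfl, by simpa using h⟩
      · simp only [List.cons_append, List.cons.injEq] at hv
        obtain ⟨rfl, rfl⟩ := hv
        exact Or.inr ⟨l, b, r, rfl, by simpa using h⟩

theorem rec_block {𝓡 : Recognizer B} {G : List B → B → List B → Prop} (hG : 𝓡.PRec G) :
    (𝓡.block G).Rec fun v => ∃ l b r, v = l ++ b :: r ∧ G l b r := by
  intro v w h
  have h1 := mem_ev_block_ctx hG [] v []
  have h2 := mem_ev_block_ctx hG [] w []
  rw [h] at h1
  simpa using h1.symm.trans h2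

theorem Rec.pRec {𝓡 : Recognizer B} {F : List B → T} (hF : 𝓡.Rec F) :
    𝓡.PRec fun l b r => F (l ++ b :: r) := by
  intro l l' b r r' hl hr
  exact hF _ _ (by simp [hl, hr])

theorem Rec.prod {𝓡 𝓢 : Recognizer B} {F₁ : List B → T₁} {F₂ : List B → T₂} (h₁ : 𝓡.Rec F₁)
    (h₂ : 𝓢.Rec F₂) (op : T₁ → T₂ → T) : (𝓡.prod 𝓢).Rec fun v => op (F₁ v) (F₂ v) := by
  intro v w h
  obtain ⟨h, h'⟩ := ev_prod_eq.1 h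
  simp only [h₁ v w h, h₂ v w h']

theorem PRec.prod {𝓡 𝓢 : Recognizer B} {F₁ : List B → B → List B → T₁}
    {F₂ : List B → B → List B → T₂} (h₁ : 𝓡.PRec F₁) (h₂ : 𝓢.PRec F₂) (op : T₁ → T₂ → T) :
    (𝓡.prod 𝓢).PRec fun l b r => op (F₁ l b r) (F₂ l b r) := by
  intro l l' b r r' hl hr
  obtain ⟨hl, hl'⟩ := ev_prod_eq.1 hl
  obtain ⟨hr, hr'⟩ := ev_prod_eq.1 hr
  simp only [h₁ _ _ b _ _ hl hr, h₂ _ _ b _ _ hl' hr']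

theorem Rec.comap {𝓡 : Recognizer B} {F : List B → T} (hF : 𝓡.Rec F) (c : B' → B) :
    (𝓡.comap c).Rec fun v => F (v.map c) := by
  intro v w h
  exact hF _ _ (by rwa [ev_comap, ev_comap] at h)

theorem PRec.comap {𝓡 : Recognizer B} {G : List B → B → List B → T} (hG : 𝓡.PRec G)
    (c : B' → B) : (𝓡.comap c).PRec fun l b r => G (l.map c) (c b) (r.map c) := by
  intro l l' b r r' hl hr
  rw [ev_comap, ev_comap] at hl hr
  exact hG _ _ _ _ _ hl hr

end Recognizer

/-! ### Recognizable properties of words with valuations -/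

section Recognizable

variable {A ι κ T T₁ T₂ : Type*}

/-- The word whose letters carry the sets of variables that are placed there. -/
def enc (u : List A) (σ : ι → Fin u.length) : List (A × Set ι) :=
  List.ofFn fun j => (u.get j, {x | σ x = j})

@[simp] theorem length_enc (u : List A) (σ : ι → Fin u.length) : (enc u σ).length = u.length := by
  simp [enc]

theorem getElem_enc (u : List A) (σ : ι → Fin u.length) (j : ℕ) (h : j < (enc u σ).length) :
    (enc u σ)[j] = (u[j]'(by simpa using h), {x | (σ x : ℕ) = j}) := by
  simp [enc, Fin.ext_iff]

theorem enc_eq_take_cons_drop (u : List A) (σ : ι → Fin u.length) (i : Fin u.length) :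
    enc u σ = (enc u σ).take i ++ (u.get i, {x | σ x = i}) :: (enc u σ).drop (i + 1) := by
  have h : (i : ℕ) < (enc u σ).length := by simp
  have := getElem_enc u σ i h
  conv_lhs => rw [← List.take_append_drop i (enc u σ), List.drop_eq_getElem_cons h, this]
  simp [Fin.ext_iff]

/-- A function of words with valuations that is recognized by a finite aperiodic monoid. -/
def IsRec (f : ∀ u : List A, (ι → Fin u.length) → T) : Prop :=
  ∃ (𝓡 : Recognizer (A × Set ι)) (F : List (A × Set ι) → T),
    𝓡.Rec F ∧ ∀ u σ, f u σ = F (enc u σ)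

/-- The version of `IsRec` for words with a valuation and a position. -/
def IsPRec (f : ∀ u : List A, (ι → Fin u.length) → Fin u.length → T) : Prop :=
  ∃ (𝓡 : Recognizer (A × Set ι)) (G : List (A × Set ι) → A × Set ι → List (A × Set ι) → T),
    𝓡.PRec G ∧ ∀ u σ i, f u σ i =
      G ((enc u σ).take i) (u.get i, {x | σ x = i}) ((enc u σ).drop (i + 1))

theorem isRec_const (t : T) : IsRec fun (u : List A) (_ : ι → Fin u.length) => t :=
  ⟨.triv _, fun _ => t, fun _ _ _ => rfl, fun _ _ => rfl⟩

theorem isPRec_const (t : T) : IsPRec fun (u : List A) (_ : ι → Fin u.length) _ => t :=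
  ⟨.triv _, fun _ _ _ => t, fun _ _ _ _ _ _ _ => rfl, fun _ _ _ => rfl⟩

theorem IsRec.map₂ {f₁ : ∀ u : List A, (ι → Fin u.length) → T₁}
    {f₂ : ∀ u : List A, (ι → Fin u.length) → T₂} (h₁ : IsRec f₁) (h₂ : IsRec f₂)
    (op : T₁ → T₂ → T) : IsRec fun u σ => op (f₁ u σ) (f₂ u σ) := by
  obtain ⟨𝓡, F, hF, h⟩ := h₁
  obtain ⟨𝓢, F', hF', h'⟩ := h₂
  exact ⟨_, _, hF.prod hF' op, fun u σ => by simp only [h, h']⟩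

theorem IsRec.map {f : ∀ u : List A, (ι → Fin u.length) → T₁} (h : IsRec f) (op : T₁ → T) :
    IsRec fun u σ => op (f u σ) :=
  h.map₂ h fun a _ => op a

theorem IsPRec.map₂ {f₁ : ∀ u : List A, (ι → Fin u.length) → Fin u.length → T₁}
    {f₂ : ∀ u : List A, (ι → Fin u.length) → Fin u.length → T₂} (h₁ : IsPRec f₁) (h₂ : IsPRec f₂)
    (op : T₁ → T₂ → T) : IsPRec fun u σ i => op (f₁ u σ i) (f₂ u σ i) := by
  obtain ⟨𝓡, F, hF, h⟩ := h₁
  obtain ⟨𝓢, F', hF', h'⟩ := h₂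
  exact ⟨_, _, hF.prod hF' op, fun u σ i => by simp only [h, h']⟩

theorem IsRec.isPRec {f : ∀ u : List A, (ι → Fin u.length) → T} (h : IsRec f) :
    IsPRec fun u σ _ => f u σ := by
  obtain ⟨𝓡, F, hF, h⟩ := h
  exact ⟨𝓡, _, hF.pRec, fun u σ i =>
    (h u σ).trans (congrArg F (enc_eq_take_cons_drop u σ i))⟩

theorem enc_comp (u : List A) (g : ι → κ) (σ : κ → Fin u.length) :
    enc u (σ ∘ g) = (enc u σ).map fun b => (b.1, g ⁻¹' b.2) := by
  simp only [enc, List.map_ofFn]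
  rfl

theorem IsRec.comap {f : ∀ u : List A, (ι → Fin u.length) → T} (h : IsRec f) (g : ι → κ) :
    IsRec fun (u : List A) (σ : κ → Fin u.length) => f u (σ ∘ g) := by
  obtain ⟨𝓡, F, hF, h⟩ := h
  exact ⟨_, _, hF.comap fun b => (b.1, g ⁻¹' b.2), fun u σ => by simp only [h, enc_comp]⟩

theorem IsPRec.comap {f : ∀ u : List A, (ι → Fin u.length) → Fin u.length → T} (h : IsPRec f)
    (g : ι → κ) : IsPRec fun (u : List A) (σ : κ → Fin u.length) => f u (σ ∘ g) := by
  obtain ⟨𝓡, F, hF, h⟩ := h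
  refine ⟨_, _, hF.comap fun b => (b.1, g ⁻¹' b.2), fun u σ i => ?_⟩
  simp only [h, enc_comp, List.map_take, List.map_drop]
  rfl

/-- Positions of `u` correspond to factorizations of `enc u σ` around a letter, which is what
`rec_block` quantifies over. -/
theorem IsPRec.exists {f : ∀ u : List A, (ι → Fin u.length) → Fin u.length → Prop}
    (h : IsPRec f) : IsRec fun u σ => ∃ i, f u σ i := by
  obtain ⟨𝓡, F, hF, h⟩ := h
  refine ⟨_, _, Recognizer.rec_block hF, fun u σ => propext ⟨?_, ?_⟩⟩
  · rintro ⟨i, hi⟩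
    exact ⟨_, _, _, enc_eq_take_cons_drop u σ i, by rwa [← h]⟩
  · rintro ⟨l, b, r, hv, hF⟩
    have hl : l.length < u.length := by
      rw [← length_enc u σ, hv]; simp
    refine ⟨⟨l.length, hl⟩, ?_⟩
    have h2 := enc_eq_take_cons_drop u σ ⟨l.length, hl⟩
    have h3 : (enc u σ).take l.length = l := by simp [hv]
    have h4 : (enc u σ).drop (l.length + 1) = r := by simp [hv]
    rw [h]
    dsimp only at h2 ⊢
    rw [h3, h4] at h2 ⊢
    rw [hv, List.append_cancel_left_eq, List.cons.injEq] at h2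
    rwa [← h2.1]

theorem enc_update [DecidableEq ι] (u : List A) (σ : ι → Fin u.length) (x : ι)
    (i : Fin u.length) :
    enc u (Function.update σ x i) =
      ((enc u σ).take i).map (fun b => (b.1, b.2 \ {x})) ++
        (u.get i, insert x {y | σ y = i}) ::
          ((enc u σ).drop (i + 1)).map (fun b => (b.1, b.2 \ {x})) := by
  have key (j : Fin u.length) (hj : i ≠ j) :
      {y | Function.update σ x i y = j} = {y | σ y = j} \ {x} := by
    ext y
    by_cases h : y = x
    · subst h; simp [hj]
    · simp [h]
  have key' : {y | Function.update σ x i y = i} = insert x {y | σ y = i} := by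
    ext y
    by_cases h : y = x
    · subst h; simp
    · simp [h]
  rw [enc_eq_take_cons_drop u _ i, key']
  congr 1
  · refine List.ext_getElem (by simp) fun j h _ => ?_
    have hj : j < i := by simp at h; omega
    have := key ⟨j, by omega⟩ (by simp [Fin.ext_iff]; omega)
    simp only [List.getElem_take, List.getElem_map, getElem_enc]
    simpa [Fin.ext_iff] using this
  · congr 1
    refine List.ext_getElem (by simp) fun j h _ => ?_
    have hj : i + 1 + j < u.length := by simp at h; omega
    have := key ⟨i + 1 + j, hj⟩ (by simp [Fin.ext_iff]; omega)
    simp only [List.getElem_drop, List.getElem_map, getElem_enc]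
    simpa [Fin.ext_iff] using this

/-- Moving `x` to position `i` erases its mark elsewhere, which is a letterwise relabelling, and
adds it at `i`. The same monoid on relabelled letters therefore evaluates both sides. -/
theorem IsRec.update [DecidableEq ι] {f : ∀ u : List A, (ι → Fin u.length) → T} (h : IsRec f)
    (x : ι) : IsPRec fun u σ i => f u (Function.update σ x i) := by
  obtain ⟨𝓡, F, hF, h⟩ := h
  refine ⟨𝓡.comap fun b => (b.1, b.2 \ {x}), fun l b r =>
    F (l.map (fun b => (b.1, b.2 \ {x})) ++ (b.1, insert x b.2) ::
      r.map (fun b => (b.1, b.2 \ {x}))), ?_, fun u σ i => ?_⟩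
  · intro l l' b r r' hl hr
    rw [Recognizer.ev_comap, Recognizer.ev_comap] at hl hr
    exact hF _ _ (by simp [hl, hr])
  · simp only [h, enc_update]

theorem isRec_le (x y : ι) : IsRec fun (u : List A) (σ : ι → Fin u.length) => σ x ≤ σ y := by
  let G : List (A × Set ι) → A × Set ι → List (A × Set ι) → Prop := fun _ b _ => x ∈ b.2
  have hG : (Recognizer.triv (A × Set ι)).PRec G := fun _ _ _ _ _ _ _ => rfl
  have h1 : IsPRec fun (u : List A) (σ : ι → Fin u.length) i => σ y = i ∧ σ x ≤ i := by
    -- At the position of `y`, the mark `x` is either on the same letter or strictly to the left;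
    -- the block monoid over the trivial one detects its occurrence in the left part.
    refine ⟨(Recognizer.triv (A × Set ι)).block G, fun l b _ =>
        y ∈ b.2 ∧ (x ∈ b.2 ∨ ∃ l' b' r', l = l' ++ b' :: r' ∧ x ∈ b'.2),
      fun l l' b r r' hl hr => ?_, fun u σ i => ?_⟩
    · have := Recognizer.rec_block hG l l' hl
      simp only [G] at this
      simp only [this]
    · refine propext (and_congr Iff.rfl ?_)
      rw [le_iff_eq_or_lt]
      refine or_congr Iff.rfl ⟨fun hlt => ?_, ?_⟩
      · have hlt' : (σ x : ℕ) < i := hlt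
        have hx : (σ x : ℕ) < ((enc u σ).take i).length := by simp; omega
        refine ⟨((enc u σ).take i).take (σ x), ((enc u σ).take i)[(σ x : ℕ)],
          ((enc u σ).take i).drop (σ x + 1), ?_, ?_⟩
        · rw [← List.drop_eq_getElem_cons hx, List.take_append_drop]
        · simp [getElem_enc]
      · rintro ⟨l, b, r, hv, hx⟩
        have hl : l.length < ((enc u σ).take i).length := by rw [hv]; simp
        have hb : ((enc u σ).take i)[l.length] = b := by simp [hv]
        rw [List.getElem_take, getElem_enc] at hb
        simp only [List.length_take, length_enc] at hl
        rw [← hb] at hx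
        simp only [Set.mem_ofPred_eq] at hx
        rw [Fin.lt_def]
        omega
  obtain ⟨𝓡, F, hF, h⟩ := h1.exists
  exact ⟨𝓡, F, hF, fun u σ => by rw [← h]; simp⟩

theorem isRec_letter (a : A) (x : ι) :
    IsRec fun (u : List A) (σ : ι → Fin u.length) => u.get (σ x) = a := by
  have h1 : IsPRec fun (u : List A) (σ : ι → Fin u.length) i => σ x = i ∧ u.get i = a :=
    ⟨.triv _, fun _ b _ => x ∈ b.2 ∧ b.1 = a, fun _ _ _ _ _ _ _ => rfl, fun _ _ _ => rfl⟩
  obtain ⟨𝓡, F, hF, h⟩ := h1.exists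
  exact ⟨𝓡, F, hF, fun u σ => by rw [← h]; simp⟩

theorem FO.isRec_sat (φ : FO A) :
    IsRec fun (u : List A) (σ : ℕ → Fin u.length) => φ.Sat u σ := by
  induction φ with
  | top => exact isRec_const True
  | letter a x => exact isRec_letter a x
  | le x y => exact isRec_le x y
  | not φ ih => exact ih.map Not
  | and φ ψ ih₁ ih₂ => exact ih₁.map₂ ih₂ And
  | all x φ ih =>
    obtain ⟨𝓡, F, hF, h⟩ := (((ih.map Not).update x).exists).map Not
    exact ⟨𝓡, F, hF, fun u σ => by rw [← h]; simp [FO.Sat]⟩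

theorem StepWFO.isRec_sem {R : Type*} (Ψ : StepWFO A R) :
    IsRec fun (u : List A) (σ : ℕ → Fin u.length) => Ψ.sem u σ := by
  classical
  induction Ψ with
  | const r => exact isRec_const r
  | ite φ Ψ₁ Ψ₂ ih₁ ih₂ =>
    obtain ⟨𝓡, F, hF, h⟩ := φ.isRec_sat.map₂ (ih₁.map₂ ih₂ Prod.mk)
      fun p s => if p then s.1 else s.2
    refine ⟨𝓡, F, hF, fun u σ => ?_⟩
    rw [← h]
    simp [StepWFO.sem]

end Recognizable

/-! ### Decomposition of weighted formulas into guarded products -/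

section GuardedProduct

variable {A R ι κ : Type*}

/-- A product `∏_x` restricted to the valuations that satisfy a guard, in semantic form. -/
structure GuardedProduct (A R ι : Type*) where
  guard : ∀ u : List A, (ι → Fin u.length) → Prop
  weight : ∀ u : List A, (ι → Fin u.length) → Fin u.length → R
  isRec_guard : IsRec guard
  isPRec_weight : IsPRec weight

namespace GuardedProduct

open Classical in
/-- The semantics of a guarded product. -/
noncomputable def sem (G : GuardedProduct A R ι) (u : List A) (σ : ι → Fin u.length) :
    Multiset (List R) :=
  if G.guard u σ then {List.ofFn (G.weight u σ)} else 0

/-- Substitution of variables. -/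
def comap (G : GuardedProduct A R ι) (g : ι → κ) : GuardedProduct A R κ where
  guard u σ := G.guard u (σ ∘ g)
  weight u σ := G.weight u (σ ∘ g)
  isRec_guard := G.isRec_guard.comap g
  isPRec_weight := G.isPRec_weight.comap g

theorem sem_comap (G : GuardedProduct A R ι) (g : ι → κ) (u : List A) (σ : κ → Fin u.length) :
    (G.comap g).sem u σ = G.sem u (σ ∘ g) := rfl

/-- Strengthening of the guard. -/
def restrict (G : GuardedProduct A R ι) (p : ∀ u : List A, (ι → Fin u.length) → Prop)
    (hp : IsRec p) : GuardedProduct A R ι where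
  guard u σ := p u σ ∧ G.guard u σ
  weight := G.weight
  isRec_guard := hp.map₂ G.isRec_guard And
  isPRec_weight := G.isPRec_weight

open Classical in
theorem sem_restrict (G : GuardedProduct A R ι) (p : ∀ u : List A, (ι → Fin u.length) → Prop)
    (hp : IsRec p) (u : List A) (σ : ι → Fin u.length) :
    (G.restrict p hp).sem u σ = if p u σ then G.sem u σ else 0 := by
  by_cases h : p u σ <;> simp [sem, restrict, h]

/-- The product `∏_x Ψ`, with the trivial guard. -/
noncomputable def ofProd (x : ℕ) (Ψ : StepWFO A R) : GuardedProduct A R ℕ where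
  guard _ _ := True
  weight u σ i := Ψ.sem u (Function.update σ x i)
  isRec_guard := isRec_const True
  isPRec_weight := Ψ.isRec_sem.update x

theorem sem_ofProd (x : ℕ) (Ψ : StepWFO A R) (u : List A) (σ : ℕ → Fin u.length) :
    (ofProd x Ψ).sem u σ = WFO.sem u σ (.prod x Ψ) := by
  simp [sem, ofProd, WFO.sem]

open Classical in
/-- Case distinction by a formula. -/
noncomputable def ite (φ : FO A) (G₁ G₂ : GuardedProduct A R ℕ) : GuardedProduct A R ℕ where
  guard u σ := if φ.Sat u σ then G₁.guard u σ else G₂.guard u σ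
  weight u σ i := if φ.Sat u σ then G₁.weight u σ i else G₂.weight u σ i
  isRec_guard := φ.isRec_sat.map₂ (G₁.isRec_guard.map₂ G₂.isRec_guard Prod.mk)
    fun p s => if p then s.1 else s.2
  isPRec_weight := φ.isRec_sat.isPRec.map₂ (G₁.isPRec_weight.map₂ G₂.isPRec_weight Prod.mk)
    fun p s => if p then s.1 else s.2

open Classical in
theorem sem_ite (φ : FO A) (G₁ G₂ : GuardedProduct A R ℕ) (u : List A) (σ : ℕ → Fin u.length) :
    (ite φ G₁ G₂).sem u σ = if φ.Sat u σ then G₁.sem u σ else G₂.sem u σ := by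
  by_cases h : φ.Sat u σ <;> simp [sem, ite, h]

/-- A formula without sums is a single guarded product. -/
theorem exists_sem_eq [Nonempty R] (Φ : WFO A R) (h₁ : Φ.PlusFree) (h₂ : Φ.SumFree) :
    ∃ G : GuardedProduct A R ℕ, ∀ u σ, Φ.sem u σ = G.sem u σ := by
  induction Φ with
  | zero =>
    -- The weight is a dummy value, since the guard never holds.
    exact ⟨⟨fun _ _ => False, fun _ _ _ => Classical.arbitrary R, isRec_const _, isPRec_const _⟩,
      fun u σ => by simp [sem, WFO.sem]⟩
  | prod x Ψ => exact ⟨ofProd x Ψ, fun u σ => (sem_ofProd x Ψ u σ).symm⟩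
  | ite φ Φ₁ Φ₂ ih₁ ih₂ =>
    obtain ⟨G₁, hG₁⟩ := ih₁ h₁.1 h₂.1
    obtain ⟨G₂, hG₂⟩ := ih₂ h₁.2 h₂.2
    exact ⟨ite φ G₁ G₂, fun u σ => by rw [sem_ite, WFO.sem, hG₁, hG₂]⟩
  | add Φ₁ Φ₂ ih₁ ih₂ => exact h₁.elim
  | sum x Φ ih => exact h₂.elim

/-- The product `G` with its outer variables all placed at a new variable `x₀`, which the guard
`∀ y, x₀ ≤ y` holds at the first position. -/
noncomputable def close {k : ℕ} (G : GuardedProduct A R (ℕ ⊕ Fin k)) :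
    GuardedProduct A R (Fin (k + 1)) :=
  (G.comap (Sum.elim (fun _ => 0) Fin.succ)).restrict
    (fun u τ => FO.Sat u (τ ∘ fun _ => 0) (.all 1 (.le 0 1)))
    ((FO.all 1 (.le 0 1)).isRec_sat.comap fun _ => 0)

theorem sat_first_iff {u : List A} (hu : 0 < u.length) (σ : ℕ → Fin u.length) :
    FO.Sat u σ (.all 1 (.le 0 1)) ↔ σ 0 = ⟨0, hu⟩ := by
  simp only [FO.Sat, ne_eq, zero_ne_one, not_false_eq_true, Function.update_of_ne,
    Function.update_self]
  constructor
  · intro h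
    exact Fin.ext (Nat.le_zero.1 (h ⟨0, hu⟩))
  · intro h i
    rw [h]
    exact Nat.zero_le _

/-- A sentence may be evaluated with all outer variables at the first position. Merging them into
one summed variable leaves finitely many variables, as the marking automaton needs, and the guard
removes every other value of that variable. -/
theorem sum_sem_close {k : ℕ} (G : GuardedProduct A R (ℕ ⊕ Fin k)) {u : List A}
    (hu : 0 < u.length) :
    ∑ τ, G.close.sem u τ =
      ∑ τ : Fin k → Fin u.length, G.sem u (Sum.elim (fun _ => ⟨0, hu⟩) τ) := by
  classical
  rw [← (Fin.consEquiv fun _ : Fin (k + 1) => Fin u.length).sum_comp, Fintype.sum_prod_type,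
    Finset.sum_eq_single ⟨0, hu⟩]
  · refine Finset.sum_congr rfl fun τ _ => ?_
    rw [close, sem_restrict, sem_comap, if_pos]
    · congr 1
      funext x
      rcases x with x | x <;> rfl
    · rw [sat_first_iff hu]; rfl
  · intro i _ hi
    refine Finset.sum_eq_zero fun τ _ => ?_
    rw [close, sem_restrict, if_neg]
    rw [sat_first_iff hu]
    exact hi
  · simp

theorem subsingleton_guard_close (G : GuardedProduct A R (ℕ ⊕ Fin 0)) (u : List A) :
    {τ | G.close.guard u τ}.Subsingleton := by
  intro τ hτ τ' hτ'
  have hu : 0 < u.length := (Nat.zero_le _).trans_lt (τ 0).2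
  have h := (sat_first_iff hu _).1 hτ.1
  have h' := (sat_first_iff hu _).1 hτ'.1
  funext x
  obtain rfl : x = 0 := Fin.ext (by omega)
  exact h.trans h'.symm

end GuardedProduct

/-- A guarded product below `k` sums over positions, which are held by variables of their own. -/
structure Monomial (A R : Type*) where
  k : ℕ
  body : GuardedProduct A R (ℕ ⊕ Fin k)

namespace Monomial

/-- The semantics of a monomial. -/
noncomputable def sem (m : Monomial A R) (u : List A) (σ : ℕ → Fin u.length) :
    Multiset (List R) :=
  ∑ τ : Fin m.k → Fin u.length, m.body.sem u (Sum.elim σ τ)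

/-- Strengthening of the guard. -/
def restrict (m : Monomial A R) (p : ∀ u : List A, (ℕ → Fin u.length) → Prop)
    (hp : IsRec p) : Monomial A R where
  k := m.k
  body := m.body.restrict (fun u σ => p u (σ ∘ Sum.inl)) (hp.comap Sum.inl)

open Classical in
theorem sem_restrict (m : Monomial A R) (p : ∀ u : List A, (ℕ → Fin u.length) → Prop)
    (hp : IsRec p) (u : List A) (σ : ℕ → Fin u.length) :
    (m.restrict p hp).sem u σ = if p u σ then m.sem u σ else 0 := by
  change ∑ τ : Fin m.k → Fin u.length, (m.body.restrict _ (hp.comap Sum.inl)).sem u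
    (Sum.elim σ τ) = _
  simp only [GuardedProduct.sem_restrict, Sum.elim_comp_inl]
  by_cases h : p u σ <;> simp [h, sem]

/-- The variables of the body of `∑_x m` as variables of the new monomial. -/
def bind (x : ℕ) {k : ℕ} : ℕ ⊕ Fin k → ℕ ⊕ Fin (k + 1) :=
  Sum.elim (fun y => if y = x then .inr 0 else .inl y) fun j => .inr j.succ

/-- The monomial `∑_x m`. -/
def sum (x : ℕ) (m : Monomial A R) : Monomial A R where
  k := m.k + 1
  body := m.body.comap (bind x)

theorem sem_sum (x : ℕ) (m : Monomial A R) (u : List A) (σ : ℕ → Fin u.length) :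
    (m.sum x).sem u σ = ∑ i, m.sem u (Function.update σ x i) := by
  change ∑ τ : Fin (m.k + 1) → Fin u.length, (m.body.comap (bind x)).sem u (Sum.elim σ τ) =
    ∑ i, ∑ τ : Fin m.k → Fin u.length, m.body.sem u (Sum.elim (Function.update σ x i) τ)
  rw [← (Fin.consEquiv fun _ : Fin (m.k + 1) => Fin u.length).sum_comp, Fintype.sum_prod_type]
  refine Finset.sum_congr rfl fun i _ => Finset.sum_congr rfl fun τ _ => ?_
  rw [GuardedProduct.sem_comap]
  congr 1
  funext y
  rcases y with y | y
  · by_cases h : y = x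
    · simp [bind, h, Fin.consEquiv]
    · simp [bind, h]
  · simp [bind, Fin.consEquiv]

/-- A guarded product as a monomial without sums. -/
noncomputable def ofGuarded (G : GuardedProduct A R ℕ) : Monomial A R where
  k := 0
  body := G.comap Sum.inl

theorem sem_ofGuarded (G : GuardedProduct A R ℕ) (u : List A) (σ : ℕ → Fin u.length) :
    (ofGuarded G).sem u σ = G.sem u σ := by
  change ∑ τ : Fin 0 → Fin u.length, G.sem u (Sum.elim σ τ ∘ Sum.inl) = _
  simp

theorem sum_map_sum {α β ι : Type*} [AddCommMonoid β] (s : Finset ι) (L : List α)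
    (f : ι → α → β) : ∑ i ∈ s, (L.map (f i)).sum = (L.map fun a => ∑ i ∈ s, f i a).sum := by
  induction L with
  | nil => simp
  | cons a L ih => simp [Finset.sum_add_distrib, ih]

/-- Every weighted formula is a finite sum of monomials. -/
theorem exists_list_sem_eq (Φ : WFO A R) :
    ∃ L : List (Monomial A R), (∀ u σ, Φ.sem u σ = (L.map fun m => m.sem u σ).sum) ∧
      (Φ.SumFree → ∀ m ∈ L, m.k = 0) := by
  classical
  induction Φ with
  | zero => exact ⟨[], by simp [WFO.sem], by simp⟩
  | prod x Ψ =>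
    exact ⟨[ofGuarded (.ofProd x Ψ)],
      by simp [sem_ofGuarded, GuardedProduct.sem_ofProd], by simp [ofGuarded]⟩
  | ite φ Φ₁ Φ₂ ih₁ ih₂ =>
    obtain ⟨L₁, h₁, h₁'⟩ := ih₁
    obtain ⟨L₂, h₂, h₂'⟩ := ih₂
    -- Exactly one of `φ` and its negation holds, so the case distinction is the sum of the two
    -- guarded lists.
    refine ⟨L₁.map (fun m => m.restrict _ φ.isRec_sat) ++
      L₂.map (fun m => m.restrict _ φ.not.isRec_sat), fun u σ => ?_, fun hs m hm => ?_⟩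
    · by_cases h : φ.Sat u σ
      · simp [WFO.sem, FO.Sat, h, h₁, sem_restrict, Function.comp_def]
      · simp [WFO.sem, FO.Sat, h, h₂, sem_restrict, Function.comp_def]
    · rw [List.mem_append, List.mem_map, List.mem_map] at hm
      obtain ⟨m, hm, rfl⟩ | ⟨m, hm, rfl⟩ := hm
      · exact h₁' hs.1 m hm
      · exact h₂' hs.2 m hm
  | add Φ₁ Φ₂ ih₁ ih₂ =>
    obtain ⟨L₁, h₁, h₁'⟩ := ih₁
    obtain ⟨L₂, h₂, h₂'⟩ := ih₂
    refine ⟨L₁ ++ L₂, fun u σ => by simp [WFO.sem, h₁, h₂], fun hs m hm => ?_⟩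
    exact (List.mem_append.1 hm).elim (h₁' hs.1 m) (h₂' hs.2 m)
  | sum x Φ ih =>
    obtain ⟨L, h, -⟩ := ih
    refine ⟨L.map (Monomial.sum x), fun u σ => ?_, fun hs => hs.elim⟩
    simp only [WFO.sem, h, sum_map_sum, List.map_map, Function.comp_def, sem_sum]

end Monomial

end GuardedProduct

/-! ### Runs of weighted automata -/

namespace WAut

variable {A R : Type*}

/-- Aperiodicity, with the bound valid for all large exponents. -/
def EventuallyAperiodic (𝒜 : WAut A R) : Prop :=
  ∀ᶠ m in Filter.atTop, ∀ (p q : 𝒜.Q) (u : List A),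
    (wordPow u m ∈ 𝒜.lang p q ↔ wordPow u (m + 1) ∈ 𝒜.lang p q)

theorem EventuallyAperiodic.aperiodic {𝒜 : WAut A R} (h : 𝒜.EventuallyAperiodic) :
    𝒜.Aperiodic := by
  obtain ⟨m, hm, h⟩ := ((Filter.eventually_ge_atTop 1).and h).exists
  exact ⟨m, hm, fun p q u _ => h p q u⟩

/-- The successful runs with label `u`, together with their first and last states. -/
def successful (𝒜 : WAut A R) (u : List A) : Set (𝒜.Q × 𝒜.Q × List 𝒜.Δ) :=
  {x | x.1 ∈ 𝒜.I ∧ x.2.1 ∈ 𝒜.F ∧ x.2.2 ∈ 𝒜.runs x.1 x.2.1 u}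

theorem finite_successful [Finite A] (𝒜 : WAut A R) (u : List A) : (𝒜.successful u).Finite := by
  refine (Set.finite_univ.prod (Set.finite_univ.prod
    (Set.finite_iUnion fun p => Set.finite_iUnion fun q => 𝒜.finite_runs p q u))).subset ?_
  rintro ⟨p, q, ρ⟩ h
  simp only [Set.mem_prod, Set.mem_univ, true_and, Set.mem_iUnion]
  exact ⟨p, q, h.2.2⟩

/-- Flattening the semantics to one sum over one index set lets it be compared with other sums by
bijections. -/
theorem usem_eq_sum_successful [Finite A] (𝒜 : WAut A R) (u : PWord A) :
    𝒜.usem u = ∑ x ∈ (𝒜.finite_successful u.1).toFinset, {𝒜.weightSeq x.2.2} := by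
  have h (p q : 𝒜.Q) : 𝒜.usemFrom p q u =
      ∑ ρ ∈ (𝒜.finite_runs p q u.1).toFinset, {𝒜.weightSeq ρ} := by
    rw [usemFrom, ← Multiset.sum_map_singleton (Multiset.map _ _), Multiset.map_map]
    rfl
  simp only [usem, h]
  rw [← Finset.sum_product', Finset.sum_sigma']
  refine Finset.sum_nbij' (fun x => (x.1.1, x.1.2, x.2)) (fun x => ⟨(x.1, x.2.1), x.2.2⟩)
    ?_ ?_ ?_ ?_ ?_
  · simp +contextual [successful]
  · simp +contextual [successful]
  · simp
  · simp
  · simp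

end WAut

/-! ### Words in which every variable is marked at most once -/

section Marks

variable {A ι : Type*}

/-- Reading `v`, in which no variable of `S` is marked and none is marked twice, extends the set
`S` of the variables marked so far to `S'`. -/
def Marks : Set ι → List (A × Set ι) → Set ι → Prop
  | S, [], S' => S = S'
  | S, b :: v, S' => Disjoint S b.2 ∧ Marks (S ∪ b.2) v S'

/-- The word `u` without any marks. -/
def bare (ι : Type*) (u : List A) : List (A × Set ι) := u.map fun a => (a, ∅)

theorem marks_append {S S' : Set ι} {v w : List (A × Set ι)} :
    Marks S (v ++ w) S' ↔ ∃ S₁, Marks S v S₁ ∧ Marks S₁ w S' := by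
  induction v generalizing S with
  | nil => simp [Marks]
  | cons b v ih => simp [Marks, ih, and_assoc]

theorem Marks.subset {S S' : Set ι} {v : List (A × Set ι)} (h : Marks S v S') : S ⊆ S' := by
  induction v generalizing S with
  | nil => exact Eq.subset h
  | cons b v ih => exact Set.subset_union_left.trans (ih h.2)

/-- The marks of a letter would be both contained in `S` and disjoint from what was marked before,
hence empty. -/
theorem Marks.eq_bare {S : Set ι} {v : List (A × Set ι)} (h : Marks S v S) :
    v = bare ι (v.map Prod.fst) := by
  induction v with
  | nil => rfl
  | cons b v ih =>
    have h1 : b.2 ⊆ S := Set.subset_union_right.trans h.2.subset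
    have h2 : b.2 = ∅ := by
      have := h.1.mono_left h1
      rwa [disjoint_self] at this
    have h3 := h.2
    rw [h2, Set.union_empty] at h3
    have h4 := ih h3
    exact congrArg₂ List.cons (Prod.ext rfl h2) h4

theorem marks_bare {S S' : Set ι} {u : List A} : Marks S (bare ι u) S' ↔ S = S' := by
  induction u with
  | nil => rfl
  | cons a u ih => simpa [Marks, bare] using ih

theorem marks_iff {S S' : Set ι} {v : List (A × Set ι)} :
    Marks S v S' ↔ (∀ b ∈ v, Disjoint S b.2) ∧ v.Pairwise (fun b c => Disjoint b.2 c.2) ∧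
      S' = S ∪ {x | ∃ b ∈ v, x ∈ b.2} := by
  induction v generalizing S with
  | nil => simp [Marks, eq_comm]
  | cons b v ih =>
    have : S ∪ {x | ∃ c ∈ b :: v, x ∈ c.2} = S ∪ b.2 ∪ {x | ∃ c ∈ v, x ∈ c.2} := by
      ext x; simp [or_assoc]
    rw [Marks, ih, this, List.pairwise_cons]
    simp only [Set.disjoint_union_left, List.forall_mem_cons]
    constructor
    · rintro ⟨h1, h2, h3, h4⟩
      exact ⟨⟨h1, fun c hc => (h2 c hc).1⟩, ⟨fun c hc => (h2 c hc).2, h3⟩, h4⟩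
    · rintro ⟨⟨h1, h2⟩, ⟨h3, h4⟩, h5⟩
      exact ⟨h1, fun c hc => ⟨h2 c hc, h3 c hc⟩, h4, h5⟩

theorem marks_enc (u : List A) (σ : ι → Fin u.length) : Marks ∅ (enc u σ) Set.univ := by
  refine marks_iff.2 ⟨fun _ _ => Set.empty_disjoint _, ?_, ?_⟩
  · rw [List.pairwise_iff_getElem]
    intro i j hi hj hij
    rw [getElem_enc, getElem_enc, Set.disjoint_left]
    intro x (hx : (σ x : ℕ) = i) (hx' : (σ x : ℕ) = j)
    omega
  · rw [Set.empty_union, eq_comm, Set.eq_univ_iff_forall]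
    intro x
    exact ⟨(enc u σ)[(σ x : ℕ)]'(by simp), List.getElem_mem _, by simp [getElem_enc]⟩

/-- Each variable is marked somewhere, which defines `σ`, and never twice, so `v` has no marks other
than those of `σ`. -/
theorem Marks.exists_eq_enc {v : List (A × Set ι)} (h : Marks ∅ v Set.univ) {u : List A}
    (hu : v.map Prod.fst = u) : ∃ σ : ι → Fin u.length, v = enc u σ := by
  subst hu
  obtain ⟨-, h1, h2⟩ := marks_iff.1 h
  rw [Set.empty_union, eq_comm, Set.eq_univ_iff_forall] at h2
  have h3 (x : ι) : ∃ j : Fin (v.map Prod.fst).length,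
      x ∈ (v[(j : ℕ)]'(by simpa using j.2)).2 := by
    obtain ⟨b, hb, hx⟩ := h2 x
    obtain ⟨j, hj, rfl⟩ := List.getElem_of_mem hb
    exact ⟨⟨j, by simpa using hj⟩, hx⟩
  choose σ hσ using h3
  refine ⟨σ, List.ext_getElem (by simp) fun j hj _ => ?_⟩
  rw [getElem_enc]
  refine Prod.ext (by simp) (Set.ext fun x => ⟨fun hx => ?_, ?_⟩)
  · rw [List.pairwise_iff_getElem] at h1
    have hσx : (σ x : ℕ) < v.length := by simpa using (σ x).2
    rcases lt_trichotomy (σ x : ℕ) j with hlt | heq | hlt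
    · exact ((h1 _ _ hσx hj hlt).le_bot ⟨hσ x, hx⟩).elim
    · exact heq
    · exact ((h1 _ _ hj hσx hlt).le_bot ⟨hx, hσ x⟩).elim
  · rintro (rfl : (σ x : ℕ) = j)
    exact hσ x

theorem map_fst_enc (u : List A) (σ : ι → Fin u.length) : (enc u σ).map Prod.fst = u := by
  refine List.ext_getElem (by simp) fun j _ _ => ?_
  simp [getElem_enc]

theorem enc_injective (u : List A) : Function.Injective (enc u : (ι → Fin u.length) → _) := by
  intro σ τ h
  funext x
  have h1 : (σ x : ℕ) < (enc u σ).length := by simp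
  have h2 : (enc u σ)[(σ x : ℕ)]'h1 = (enc u τ)[(σ x : ℕ)]'(by simp) := by simp only [h]
  rw [getElem_enc, getElem_enc] at h2
  have h3 : x ∈ {y | (σ y : ℕ) = σ x} := rfl
  rw [(Prod.mk_inj.1 h2).2] at h3
  exact Fin.ext (Eq.symm h3)

theorem wordPow_add (u : List A) (m n : ℕ) : wordPow u (m + n) = wordPow u m ++ wordPow u n := by
  rw [wordPow, List.replicate_add, List.flatten_append, wordPow, wordPow]

theorem map_fst_bare (u : List A) : (bare ι u).map Prod.fst = u := by
  simp [bare, Function.comp_def]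

/-- If only `c` variables are newly marked in a long enough power of `u`, some `N` consecutive
copies of `u` bear no marks. -/
theorem Marks.exists_bare_factor [Finite ι] {u : List A} (N c : ℕ) {m : ℕ} {S S' : Set ι}
    {v : List (A × Set ι)} (h : Marks S v S') (hv : v.map Prod.fst = wordPow u m)
    (hm : N * (c + 1) ≤ m) (hc : S'.ncard ≤ S.ncard + c) :
    ∃ x z a b, v = x ++ bare ι (wordPow u N) ++ z ∧ m = a + N + b ∧
      x.map Prod.fst = wordPow u a ∧ z.map Prod.fst = wordPow u b := by
  -- Pigeonhole on `c + 1` consecutive blocks of `N` copies: either the first block is unmarked, or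
  -- it uses up at least one of the `c` new variables.
  induction c generalizing m S v with
  | zero =>
    obtain ⟨n, rfl⟩ : ∃ n, m = N + n := ⟨m - N, by omega⟩
    rw [wordPow_add, List.map_eq_append_iff] at hv
    obtain ⟨y, z, rfl, hy, hz⟩ := hv
    obtain rfl : S = S' := Set.eq_of_subset_of_ncard_le h.subset (by omega)
    obtain ⟨S₁, h1, h2⟩ := marks_append.1 h
    obtain rfl : S = S₁ := h1.subset.antisymm h2.subset
    have := h1.eq_bare
    rw [hy] at this
    exact ⟨[], z, 0, n, by rw [this]; rfl, by omega, rfl, hz⟩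
  | succ c ih =>
    have hle : N * (c + 1 + 1) = N + N * (c + 1) := by ring
    obtain ⟨n, rfl⟩ : ∃ n, m = N + n := ⟨m - N, by omega⟩
    rw [wordPow_add, List.map_eq_append_iff] at hv
    obtain ⟨y, z, rfl, hy, hz⟩ := hv
    obtain ⟨S₁, h1, h2⟩ := marks_append.1 h
    by_cases hS : S = S₁
    · subst hS
      have := h1.eq_bare
      rw [hy] at this
      exact ⟨[], z, 0, n, by rw [this]; rfl, by omega, rfl, hz⟩
    · have hlt := Set.ncard_lt_ncard (h1.subset.ssubset_of_ne hS)
      obtain ⟨x', z', a, b, rfl, rfl, hx', hz'⟩ := ih h2 hz (by omega) (by omega)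
      exact ⟨y ++ x', z', N + a, b, by simp, by omega, by simp [hy, hx', wordPow_add], hz'⟩

end Marks

/-! ### The automaton of a guarded product -/

section MarkAut

variable {A R : Type*} {ι : Type} [Finite ι] (𝓡 : Recognizer (A × Set ι)) (P : 𝓡.M → Prop)
  (w : 𝓡.M → A × Set ι → 𝓡.M → R)

/-- The automaton that guesses the marks. A state consists of the value of the marked word read so
far, the value of the marked word still to be read, and the set of the variables marked so far. -/
def markAut : WAut A R where
  Q := 𝓡.M × 𝓡.M × Set ι
  finite_Q := inferInstance
  -- The marks on the letter are recovered as the difference of the two sets, so no variable can be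
  -- marked twice.
  Δ := {d | d.1.2.2 ⊆ d.2.2.2.2 ∧ d.2.2.1 = d.1.1 * 𝓡.hom (d.2.1, d.2.2.2.2 \ d.1.2.2) ∧
    d.1.2.1 = 𝓡.hom (d.2.1, d.2.2.2.2 \ d.1.2.2) * d.2.2.2.1}
  wgt δ := w δ.1.1.1 (δ.1.2.1, δ.1.2.2.2.2 \ δ.1.1.2.2) δ.1.2.2.2.1
  I := {p | p.1 = 1 ∧ P p.2.1 ∧ p.2.2 = ∅}
  F := {q | q.2.1 = 1 ∧ q.2.2 = Set.univ}

namespace markAut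

variable {𝓡 P w}

/-- The marked word read by a sequence of transitions. -/
def markedLabel (ρ : List (markAut 𝓡 P w).Δ) : List (A × Set ι) :=
  ρ.map fun δ => (δ.1.2.1, δ.1.2.2.2.2 \ δ.1.1.2.2)

theorem map_fst_markedLabel (ρ : List (markAut 𝓡 P w).Δ) :
    (markedLabel ρ).map Prod.fst = (markAut 𝓡 P w).label ρ := by
  simp [markedLabel, WAut.label, Function.comp_def]

variable (𝓡) in
/-- The marked word `v` leads from the state `p` to the state `q`. -/
def Leads (p : 𝓡.M × 𝓡.M × Set ι) (v : List (A × Set ι)) (q : 𝓡.M × 𝓡.M × Set ι) : Prop :=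
  q.1 = p.1 * 𝓡.ev v ∧ p.2.1 = 𝓡.ev v * q.2.1 ∧ Marks p.2.2 v q.2.2

theorem leads_of_isRun {p q : (markAut 𝓡 P w).Q} {ρ : List (markAut 𝓡 P w).Δ}
    (h : (markAut 𝓡 P w).IsRun p q ρ) : Leads 𝓡 p (markedLabel ρ) q := by
  induction ρ generalizing p with
  | nil =>
    obtain rfl : p = q := h
    exact ⟨by simp [markedLabel], by simp [markedLabel], rfl⟩
  | cons δ ρ ih =>
    obtain ⟨rfl, h⟩ := h
    obtain ⟨h1, h2, h3⟩ := ih h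
    obtain ⟨h4, h5, h6⟩ := δ.2
    refine ⟨?_, ?_, Set.disjoint_sdiff_right, ?_⟩
    · rw [h1, h5, mul_assoc]
      exact congrArg _ (𝓡.ev_cons _ _).symm
    · rw [h6, h2, ← mul_assoc]
      exact congrArg (· * _) (𝓡.ev_cons _ _).symm
    · dsimp only
      rw [Set.union_sdiff_cancel h4]
      exact h3

theorem exists_isRun_of_leads {p q : (markAut 𝓡 P w).Q} {v : List (A × Set ι)}
    (h : Leads 𝓡 p v q) : ∃ ρ, (markAut 𝓡 P w).IsRun p q ρ ∧ markedLabel ρ = v := by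
  induction v generalizing p with
  | nil =>
    obtain ⟨h1, h2, h3⟩ := h
    exact ⟨[], Prod.ext (by simpa using h1.symm) (Prod.ext (by simpa using h2) h3), rfl⟩
  | cons b v ih =>
    obtain ⟨h1, h2, h3, h4⟩ := h
    have hb : (p.2.2 ∪ b.2) \ p.2.2 = b.2 := by
      rw [Set.union_sdiff_left]; exact h3.sdiff_eq_right
    -- The intermediate state is forced: its value read and its marks come from `p`, its value still
    -- to be read from `q`.
    obtain ⟨ρ, hρ, hv⟩ := ih (p := (p.1 * 𝓡.hom b, 𝓡.ev v * q.2.1, p.2.2 ∪ b.2))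
      ⟨by simp [h1, mul_assoc], rfl, h4⟩
    refine ⟨⟨(p, b.1, (p.1 * 𝓡.hom b, 𝓡.ev v * q.2.1, p.2.2 ∪ b.2)), ?_, ?_, ?_⟩ :: ρ,
      ⟨rfl, hρ⟩, ?_⟩
    · exact Set.subset_union_left
    · dsimp only; rw [hb]
    · dsimp only; rw [hb, h2, 𝓡.ev_cons, mul_assoc]
    · rw [markedLabel, List.map_cons]
      dsimp only
      rw [hb]
      exact congrArg _ hv

/-- The values read and the sets of marks are determined forwards from `p`, the values still to be
read backwards from `q`. -/
theorem eq_of_markedLabel_eq {p q : (markAut 𝓡 P w).Q} {ρ ρ' : List (markAut 𝓡 P w).Δ}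
    (h : (markAut 𝓡 P w).IsRun p q ρ) (h' : (markAut 𝓡 P w).IsRun p q ρ')
    (hv : markedLabel ρ = markedLabel ρ') : ρ = ρ' := by
  induction ρ generalizing p ρ' with
  | nil =>
    have := congrArg List.length hv
    simp only [markedLabel, List.length_map, List.length_nil] at this
    exact (List.length_eq_zero_iff.1 this.symm).symm
  | cons δ ρ ih =>
    rcases ρ' with _ | ⟨δ', ρ'⟩
    · simp [markedLabel] at hv
    obtain ⟨hb, hv⟩ := List.cons.inj hv
    obtain ⟨rfl, h⟩ := h
    obtain ⟨hp, h'⟩ := h'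
    obtain ⟨ha, hS⟩ := Prod.mk.inj hb
    have hv' : markedLabel ρ = markedLabel ρ' := hv
    have l := leads_of_isRun h
    have l' := leads_of_isRun h'
    obtain ⟨d1, d2, -⟩ := δ.2
    obtain ⟨d1', d2', -⟩ := δ'.2
    have hS' : δ.1.2.2.2.2 = δ'.1.2.2.2.2 := by
      rw [← Set.union_sdiff_cancel d1, ← Set.union_sdiff_cancel d1', hS, hp]
    have hq : δ.1.2.2 = δ'.1.2.2 := by
      refine Prod.ext ?_ (Prod.ext ?_ hS')
      · rw [d2, d2', ha, hS, hp]
      · rw [l.2.1, l'.2.1, hv']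
    have hδ : δ = δ' := Subtype.ext (Prod.ext hp.symm (Prod.ext ha hq))
    subst hδ
    rw [ih h h' hv']

theorem mem_lang {p q : (markAut 𝓡 P w).Q} {u : List A} :
    u ∈ (markAut 𝓡 P w).lang p q ↔ ∃ v, v.map Prod.fst = u ∧ Leads 𝓡 p v q := by
  constructor
  · rintro ⟨ρ, hρ, hu⟩
    exact ⟨_, (map_fst_markedLabel ρ).trans hu, leads_of_isRun hρ⟩
  · rintro ⟨v, hv, h⟩
    obtain ⟨ρ, hρ, rfl⟩ := exists_isRun_of_leads (P := P) (w := w) h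
    exact ⟨ρ, hρ, by rw [← map_fst_markedLabel, hv]⟩

omit [Finite ι] in
theorem ev_bare_wordPow (u : List A) (n : ℕ) :
    𝓡.ev (bare ι (wordPow u n)) = 𝓡.ev (bare ι u) ^ n := by
  induction n with
  | zero => rw [pow_zero]; rfl
  | succ n ih =>
    have h1 : wordPow u 1 = u := by simp [wordPow]
    rw [wordPow_add, h1, bare, List.map_append, 𝓡.ev_append, pow_succ, ← ih]
    rfl

omit [Finite ι] in
theorem leads_replace {p q : 𝓡.M × 𝓡.M × Set ι} {x z : List (A × Set ι)} {y y' : List A}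
    (h : Leads 𝓡 p (x ++ bare ι y ++ z) q) (hy : 𝓡.ev (bare ι y) = 𝓡.ev (bare ι y')) :
    Leads 𝓡 p (x ++ bare ι y' ++ z) q := by
  simpa only [Leads, 𝓡.ev_append, marks_append, marks_bare, hy] using h

/-- A marking of a long power contains an unmarked stretch of `N` or `N + 1` copies. Exchanging
these two lengths changes neither the monoid value nor the marks. -/
theorem eventuallyAperiodic : (markAut 𝓡 P w).EventuallyAperiodic := by
  obtain ⟨N, hN⟩ := 𝓡.aper
  -- Shrinking requires a stretch of `N + 1` unmarked copies, whereas growing requires only `N`; the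
  -- larger bound serves both.
  filter_upwards [Filter.eventually_ge_atTop ((N + 1) * (Nat.card ι + 1))] with m hm p q u
  have hc (S S' : Set ι) : S'.ncard ≤ S.ncard + Nat.card ι :=
    (Set.ncard_le_card S').trans (Nat.le_add_left _ _)
  have hm' : N * (Nat.card ι + 1) ≤ m := by nlinarith
  have hev : 𝓡.ev (bare ι (wordPow u (N + 1))) = 𝓡.ev (bare ι (wordPow u N)) := by
    rw [ev_bare_wordPow, ev_bare_wordPow, hN]
  rw [mem_lang, mem_lang]
  constructor
  · rintro ⟨v, hv, h⟩
    obtain ⟨x, z, a, b, rfl, rfl, hx, hz⟩ := h.2.2.exists_bare_factor N _ hv hm' (hc _ _)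
    refine ⟨_, ?_, leads_replace h hev.symm⟩
    simp only [List.map_append, map_fst_bare, hx, hz, ← wordPow_add]
    congr 1
    omega
  · rintro ⟨v, hv, h⟩
    obtain ⟨x, z, a, b, rfl, hab, hx, hz⟩ :=
      h.2.2.exists_bare_factor (N + 1) _ hv (hm.trans (Nat.le_succ m)) (hc _ _)
    refine ⟨_, ?_, leads_replace h hev⟩
    simp only [List.map_append, map_fst_bare, hx, hz, ← wordPow_add]
    congr 1
    omega

/-- Marks only accumulate, so mutually reachable states have equal mark sets. Every run between them
reads the bare word, which determines it. -/
theorem sccUnambiguous : (markAut 𝓡 P w).SCCUnambiguous := by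
  intro p q hpq u _ ρ hρ ρ' hρ'
  have hS : p.2.2 = q.2.2 := by
    rcases hpq with rfl | ⟨⟨v, hv, -⟩, ⟨v', hv', -⟩⟩
    · rfl
    · obtain ⟨_, -, h⟩ := mem_lang.1 hv
      obtain ⟨_, -, h'⟩ := mem_lang.1 hv'
      exact h.2.2.subset.antisymm h'.2.2.subset
  have key {ρ : List (markAut 𝓡 P w).Δ} (h : ρ ∈ (markAut 𝓡 P w).runs p q u) :
      markedLabel ρ = bare ι u := by
    have h1 := (leads_of_isRun h.1).2.2
    rw [hS] at h1
    have h2 := h1.eq_bare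
    rwa [map_fst_markedLabel, h.2] at h2
  exact eq_of_markedLabel_eq hρ.1 hρ'.1 ((key hρ).trans (key hρ').symm)

theorem mem_successful {u : List A} {x} :
    x ∈ (markAut 𝓡 P w).successful u ↔
      ∃ σ : ι → Fin u.length, P (𝓡.ev (enc u σ)) ∧ markedLabel x.2.2 = enc u σ ∧
        x.1 = (1, 𝓡.ev (enc u σ), ∅) ∧ x.2.1 = (𝓡.ev (enc u σ), 1, Set.univ) ∧
        (markAut 𝓡 P w).IsRun x.1 x.2.1 x.2.2 := by
  obtain ⟨⟨s, t, S⟩, ⟨s', t', S'⟩, ρ⟩ := x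
  constructor
  · rintro ⟨⟨h1, hP, h2⟩, ⟨h3, h4⟩, hρ, hu⟩
    dsimp only at h1 hP h2 h3 h4 hρ hu ⊢
    subst h1 h2 h3 h4
    obtain ⟨h5, h6, h7⟩ := leads_of_isRun hρ
    obtain ⟨σ, hσ⟩ := Marks.exists_eq_enc h7 ((map_fst_markedLabel ρ).trans hu)
    dsimp only at h5 h6
    rw [hσ, one_mul] at h5
    rw [hσ, mul_one] at h6
    subst h5 h6
    exact ⟨σ, hP, hσ, rfl, rfl, hρ⟩
  · rintro ⟨σ, hP, hσ, h1, h2, hρ⟩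
    dsimp only at hσ h1 h2 hρ
    obtain ⟨rfl, h3⟩ := Prod.mk.inj h1
    obtain ⟨rfl, rfl⟩ := Prod.mk.inj h3
    obtain ⟨rfl, h4⟩ := Prod.mk.inj h2
    obtain ⟨rfl, rfl⟩ := Prod.mk.inj h4
    refine ⟨⟨rfl, hP, rfl⟩, ⟨rfl, rfl⟩, hρ, ?_⟩
    rw [← map_fst_markedLabel, hσ, map_fst_enc]

/-- The prefix `l` stands for the part read before `p`. The final condition `q.2.1 = 1` forces the
second component of each state to be the value of the remaining marked word. -/
theorem weightSeq_eq {G : List (A × Set ι) → A × Set ι → List (A × Set ι) → R}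
    (hw : ∀ l b r, w (𝓡.ev l) b (𝓡.ev r) = G l b r) (l : List (A × Set ι))
    {p q : (markAut 𝓡 P w).Q} {ρ : List (markAut 𝓡 P w).Δ}
    (h : (markAut 𝓡 P w).IsRun p q ρ) (hp : p.1 = 𝓡.ev l) (hq : q.2.1 = 1) :
    (markAut 𝓡 P w).weightSeq ρ = List.ofFn fun i : Fin (markedLabel ρ).length =>
      G (l ++ (markedLabel ρ).take i) (markedLabel ρ)[i] ((markedLabel ρ).drop (i + 1)) := by
  induction ρ generalizing p l with
  | nil => rfl
  | cons δ ρ ih =>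
    obtain ⟨rfl, h⟩ := h
    have h2 := (leads_of_isRun h).2.1
    rw [hq, mul_one] at h2
    have h3 := ih (l ++ [(δ.1.2.1, δ.1.2.2.2.2 \ δ.1.1.2.2)]) h (by
      rw [δ.2.2.1, hp, 𝓡.ev_append, 𝓡.ev_cons, 𝓡.ev_nil, mul_one])
    rw [WAut.weightSeq, List.map_cons, ← WAut.weightSeq, h3]
    have h4 : (markAut 𝓡 P w).wgt δ =
        G l (δ.1.2.1, δ.1.2.2.2.2 \ δ.1.1.2.2) (markedLabel ρ) := by
      rw [← hw, ← hp, ← h2]; rfl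
    rw [h4]
    refine Eq.trans ?_ (List.ofFn_succ (n := (markedLabel ρ).length)).symm
    simp [markedLabel]
    rfl

end markAut

namespace GuardedProduct

/-- Pick representatives of the two values; `hG` makes the choice irrelevant. Values that no word
attains receive a default weight. -/
theorem exists_factor {B T : Type*} [Nonempty T] {𝓡 : Recognizer B}
    {G : List B → B → List B → T} (hG : 𝓡.PRec G) :
    ∃ w : 𝓡.M → B → 𝓡.M → T, ∀ l b r, w (𝓡.ev l) b (𝓡.ev r) = G l b r := by
  classical
  refine ⟨fun s b t => if h : ∃ l r, 𝓡.ev l = s ∧ 𝓡.ev r = t then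
    G h.choose b h.choose_spec.choose else Classical.arbitrary T, fun l b r => ?_⟩
  have h : ∃ l' r', 𝓡.ev l' = 𝓡.ev l ∧ 𝓡.ev r' = 𝓡.ev r := ⟨l, r, rfl, rfl⟩
  dsimp only
  rw [dif_pos h]
  exact hG _ _ _ _ _ h.choose_spec.choose_spec.1 h.choose_spec.choose_spec.2

/-- The automaton of a guarded product, summed over all valuations. -/
theorem exists_wAut [Finite A] [Nonempty R] (G : GuardedProduct A R ι) [Fintype ι]
    [DecidableEq ι] :
    ∃ 𝒜 : WAut A R, 𝒜.EventuallyAperiodic ∧ 𝒜.SCCUnambiguous ∧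
      ((∀ u, {σ | G.guard u σ}.Subsingleton) → 𝒜.Unambiguous) ∧
      ∀ u : PWord A, 𝒜.usem u = ∑ σ, G.sem u.1 σ := by
  classical
  obtain ⟨𝓡₁, F, hF, hgF⟩ := G.isRec_guard
  obtain ⟨𝓡₂, H, hH, hwH⟩ := G.isPRec_weight
  -- One product monoid serves both the guard and the weight.
  obtain ⟨𝓡, hF, hH⟩ : ∃ 𝓡 : Recognizer (A × Set ι), 𝓡.Rec F ∧ 𝓡.PRec H :=
    ⟨𝓡₁.prod 𝓡₂, fun v v' h => hF _ _ (Recognizer.ev_prod_eq.1 h).1, fun l l' b r r' hl hr =>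
      hH _ _ _ _ _ (Recognizer.ev_prod_eq.1 hl).2 (Recognizer.ev_prod_eq.1 hr).2⟩
  obtain ⟨w, hw⟩ := exists_factor hH
  let P : 𝓡.M → Prop := fun s => ∃ v, 𝓡.ev v = s ∧ F v
  have hP (u : List A) (σ : ι → Fin u.length) : P (𝓡.ev (enc u σ)) ↔ G.guard u σ := by
    rw [hgF]
    constructor
    · rintro ⟨v, hv, h⟩
      rwa [hF _ _ hv] at h
    · exact fun h => ⟨_, rfl, h⟩
  refine ⟨markAut 𝓡 P w, markAut.eventuallyAperiodic, markAut.sccUnambiguous, ?_, ?_⟩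
  · rintro hG u - ρ ⟨p, hp, q, hq, hρ⟩ ρ' ⟨p', hp', q', hq', hρ'⟩
    obtain ⟨σ, h1, h2, h3, h4, h5⟩ :=
      markAut.mem_successful.1 (show (p, q, ρ) ∈ WAut.successful _ u from ⟨hp, hq, hρ⟩)
    obtain ⟨σ', h1', h2', h3', h4', h5'⟩ :=
      markAut.mem_successful.1 (show (p', q', ρ') ∈ WAut.successful _ u from ⟨hp', hq', hρ'⟩)
    obtain rfl : σ = σ' := hG u ((hP u σ).1 h1) ((hP u σ').1 h1')
    dsimp only at h2 h3 h4 h5 h2' h3' h4' h5'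
    subst h3 h4 h3' h4'
    exact markAut.eq_of_markedLabel_eq h5 h5' (h2.trans h2'.symm)
  · intro u
    have hrun (σ : ι → Fin u.1.length) :
        ∃ ρ, (markAut 𝓡 P w).IsRun (1, 𝓡.ev (enc u.1 σ), ∅) (𝓡.ev (enc u.1 σ), 1, Set.univ) ρ ∧
          markAut.markedLabel ρ = enc u.1 σ :=
      markAut.exists_isRun_of_leads ⟨by simp, by simp, marks_enc _ σ⟩
    choose r hr hrl using hrun
    rw [WAut.usem_eq_sum_successful]
    simp only [sem]
    -- Only valuations satisfying the guard contribute, and `σ ↦ r σ` matches them with the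
    -- successful runs.
    rw [← Finset.sum_filter]
    symm
    refine Finset.sum_nbij (fun σ => ((1, 𝓡.ev (enc u.1 σ), ∅), (𝓡.ev (enc u.1 σ), 1, Set.univ),
      r σ)) ?_ ?_ ?_ ?_
    · intro σ hσ
      rw [Set.Finite.mem_toFinset, markAut.mem_successful]
      exact ⟨σ, (hP _ _).2 (by simpa using hσ), hrl σ, rfl, rfl, hr σ⟩
    · intro σ _ τ _ h
      have h1 : r σ = r τ := congrArg (fun x => x.2.2) h
      exact enc_injective u.1 (by rw [← hrl, ← hrl, h1])
    · rintro ⟨p, q, ρ⟩ hx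
      rw [Set.Finite.coe_toFinset, markAut.mem_successful] at hx
      obtain ⟨σ, h1, h2, h3, h4, h5⟩ := hx
      dsimp only at h2 h3 h4 h5
      subst h3 h4
      refine ⟨σ, by simpa using (hP _ _).1 h1, ?_⟩
      rw [markAut.eq_of_markedLabel_eq h5 (hr σ) (h2.trans (hrl σ).symm)]
    · intro σ _
      rw [markAut.weightSeq_eq hw [] (hr σ) rfl rfl]
      congr 1
      refine List.ext_getElem (by simp [hrl]) fun j _ _ => ?_
      simp [hwH, hrl, getElem_enc, Fin.ext_iff]

end GuardedProduct

end MarkAut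

/-! ### Disjoint unions -/

namespace WAut

variable {A R : Type*} {n : ℕ} {ℬ : Fin n → WAut A R}

/-- The transitions of a component as transitions of the disjoint union. -/
def inclΔ (ℬ : Fin n → WAut A R) (i : Fin n) (δ : (ℬ i).Δ) : (iUnion ℬ).Δ :=
  ⟨(⟨i, δ.1.1⟩, δ.1.2.1, ⟨i, δ.1.2.2⟩), rfl, δ.2⟩

theorem inclΔ_injective (i : Fin n) : Function.Injective (inclΔ ℬ i) := by
  rintro ⟨⟨p, a, q⟩, h⟩ ⟨⟨p', a', q'⟩, h'⟩ heq
  have h1 := congrArg Subtype.val heq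
  obtain ⟨h2, h3⟩ := Prod.mk.inj h1
  obtain ⟨h3, h4⟩ := Prod.mk.inj h3
  obtain rfl : p = p' := eq_of_heq (Sigma.mk.inj h2).2
  obtain rfl : q = q' := eq_of_heq (Sigma.mk.inj h4).2
  obtain rfl : a = a' := h3
  rfl

/-- No transition leaves its component, so a run stays in the component where it starts. -/
theorem isRun_iUnion_iff {i : Fin n} {p : (ℬ i).Q} {s : (iUnion ℬ).Q} {ρ : List (iUnion ℬ).Δ} :
    (iUnion ℬ).IsRun ⟨i, p⟩ s ρ ↔
      ∃ q ρ', s = ⟨i, q⟩ ∧ ρ = List.map (inclΔ ℬ i) ρ' ∧ (ℬ i).IsRun p q ρ' := by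
  induction ρ generalizing p with
  | nil =>
    constructor
    · rintro rfl
      exact ⟨p, [], rfl, rfl, rfl⟩
    · rintro ⟨q, ρ', rfl, h, hr⟩
      obtain rfl : ρ' = [] := by simpa using h.symm
      obtain rfl : p = q := hr
      rfl
  | cons δ ρ ih =>
    constructor
    · rintro ⟨h, hr⟩
      obtain ⟨d, hd⟩ := δ
      obtain ⟨j, p', q', a, hd', rfl⟩ := (mem_iUnion_Δ ℬ d).1 hd
      cases h
      obtain ⟨q, ρ', rfl, rfl, hr'⟩ := ih.1 hr
      exact ⟨q, ⟨_, hd'⟩ :: ρ', rfl, rfl, rfl, hr'⟩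
    · rintro ⟨q, ρ', rfl, h, hr⟩
      rcases ρ' with _ | ⟨δ', ρ'⟩
      · simp at h
      · obtain ⟨rfl, rfl⟩ := List.cons.inj h
        obtain ⟨rfl, hr⟩ := hr
        exact ⟨rfl, ih.2 ⟨q, ρ', rfl, rfl, hr⟩⟩

theorem label_map_inclΔ (i : Fin n) (ρ : List (ℬ i).Δ) :
    (iUnion ℬ).label (ρ.map (inclΔ ℬ i)) = (ℬ i).label ρ := by
  simp only [label, List.map_map]
  rfl

theorem weightSeq_map_inclΔ (i : Fin n) (ρ : List (ℬ i).Δ) :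
    (iUnion ℬ).weightSeq (ρ.map (inclΔ ℬ i)) = (ℬ i).weightSeq ρ := by
  simp only [weightSeq, List.map_map]
  rfl

theorem mem_runs_iUnion {i : Fin n} {p : (ℬ i).Q} {s : (iUnion ℬ).Q} {u : List A}
    {ρ : List (iUnion ℬ).Δ} :
    ρ ∈ (iUnion ℬ).runs ⟨i, p⟩ s u ↔
      ∃ q ρ', s = ⟨i, q⟩ ∧ ρ = List.map (inclΔ ℬ i) ρ' ∧ ρ' ∈ (ℬ i).runs p q u := by
  constructor
  · rintro ⟨h, hu⟩
    obtain ⟨q, ρ', rfl, rfl, h'⟩ := isRun_iUnion_iff.1 h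
    exact ⟨q, ρ', rfl, rfl, h', by rwa [label_map_inclΔ] at hu⟩
  · rintro ⟨q, ρ', rfl, rfl, h, hu⟩
    exact ⟨isRun_iUnion_iff.2 ⟨q, ρ', rfl, rfl, h⟩, by rwa [label_map_inclΔ]⟩

theorem mem_lang_iUnion {i : Fin n} {p : (ℬ i).Q} {s : (iUnion ℬ).Q} {u : List A} :
    u ∈ (iUnion ℬ).lang ⟨i, p⟩ s ↔ ∃ q, s = ⟨i, q⟩ ∧ u ∈ (ℬ i).lang p q := by
  constructor
  · rintro ⟨ρ, h⟩
    obtain ⟨q, ρ', rfl, rfl, h'⟩ := mem_runs_iUnion.1 h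
    exact ⟨q, rfl, ρ', h'⟩
  · rintro ⟨q, rfl, ρ, h⟩
    exact ⟨_, mem_runs_iUnion.2 ⟨q, ρ, rfl, rfl, h⟩⟩

theorem mem_lang_iUnion_same {i : Fin n} {p q : (ℬ i).Q} {u : List A} :
    u ∈ (iUnion ℬ).lang ⟨i, p⟩ ⟨i, q⟩ ↔ u ∈ (ℬ i).lang p q := by
  refine mem_lang_iUnion.trans ⟨?_, ?_⟩
  · rintro ⟨q', h, hu⟩
    obtain rfl : q = q' := eq_of_heq (Sigma.mk.inj h).2
    exact hu
  · exact fun hu => ⟨q, rfl, hu⟩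

/-- Finitely many eventual statements have a common exponent; this is why aperiodicity is carried in
its eventual form. -/
theorem EventuallyAperiodic.iUnion (h : ∀ i, (ℬ i).EventuallyAperiodic) :
    (iUnion ℬ).EventuallyAperiodic := by
  filter_upwards [Filter.eventually_all.2 h] with m hm
  rintro ⟨i, p⟩ s u
  rw [mem_lang_iUnion, mem_lang_iUnion]
  exact exists_congr fun q => and_congr_right fun _ => hm i p q u

theorem SCCUnambiguous.iUnion (h : ∀ i, (ℬ i).SCCUnambiguous) :
    (iUnion ℬ).SCCUnambiguous := by
  rintro ⟨i, p⟩ ⟨j, q⟩ hpq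
  have hq : ∃ q' : (ℬ i).Q, (⟨j, q⟩ : (WAut.iUnion ℬ).Q) = ⟨i, q'⟩ ∧ (ℬ i).SameSCC p q' := by
    rcases hpq with hpq | ⟨⟨u, hu, hu0⟩, v, hv, hv0⟩
    · exact ⟨p, hpq.symm, Or.inl rfl⟩
    · obtain ⟨q', hq', hu⟩ := mem_lang_iUnion.1 hu
      rw [hq', mem_lang_iUnion_same] at hv
      exact ⟨q', hq', Or.inr ⟨⟨u, hu, hu0⟩, v, hv, hv0⟩⟩
  obtain ⟨q', hq', hS⟩ := hq
  rw [hq']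
  intro u hu ρ hρ ρ' hρ'
  obtain ⟨q₁, ρ₁, h₁, rfl, hρ⟩ := mem_runs_iUnion.1 hρ
  obtain ⟨q₂, ρ₂, h₂, rfl, hρ'⟩ := mem_runs_iUnion.1 hρ'
  obtain rfl : q' = q₁ := eq_of_heq (Sigma.mk.inj h₁).2
  obtain rfl : q' = q₂ := eq_of_heq (Sigma.mk.inj h₂).2
  rw [h i p q' hS u hu hρ hρ']

theorem usem_iUnion [Finite A] (ℬ : Fin n → WAut A R) (u : PWord A) :
    (iUnion ℬ).usem u = ∑ i, (ℬ i).usem u := by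
  simp only [usem_eq_sum_successful]
  rw [Finset.sum_sigma']
  symm
  refine Finset.sum_nbij (fun x => (⟨x.1, x.2.1⟩, ⟨x.1, x.2.2.1⟩, x.2.2.2.map (inclΔ ℬ x.1)))
    ?_ ?_ ?_ ?_
  · rintro ⟨i, p, q, ρ⟩ hx
    simp only [Finset.mem_sigma, Finset.mem_univ, true_and, Set.Finite.mem_toFinset] at hx ⊢
    exact ⟨hx.1, hx.2.1, mem_runs_iUnion.2 ⟨q, ρ, rfl, rfl, hx.2.2⟩⟩
  · rintro ⟨i, p, q, ρ⟩ - ⟨j, p', q', ρ'⟩ - h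
    obtain ⟨h1, h2⟩ := Prod.mk.inj h
    obtain ⟨h3, h4⟩ := Prod.mk.inj h2
    clear h h2
    dsimp only at h1 h3 h4
    cases h1
    cases h3
    rw [List.map_injective_iff.2 (inclΔ_injective i) h4]
  · rintro ⟨⟨i, p⟩, s, ρ⟩ hx
    simp only [Set.Finite.coe_toFinset] at hx
    obtain ⟨hp, hs, hρ⟩ := hx
    obtain ⟨q, ρ', hq, hρ', hr⟩ := mem_runs_iUnion.1 hρ
    dsimp only at hp hs hq hρ'
    subst hq hρ'
    exact ⟨⟨i, p, q, ρ'⟩, by simpa using ⟨hp, hs, hr⟩, rfl⟩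
  · rintro ⟨i, p, q, ρ⟩ -
    rw [weightSeq_map_inclΔ]

end WAut

/-! ### From weighted sentences to automata -/

namespace WFO

variable {A R : Type*}

theorem sem_eq_zero_of_isEmpty [IsEmpty R] (Φ : WFO A R) (u : List A) (σ : ℕ → Fin u.length) :
    Φ.sem u σ = 0 := by
  induction Φ generalizing σ with
  | zero => rfl
  -- Evaluating any step formula would produce an element of the empty set of weights.
  | prod x Ψ => exact isEmptyElim (Ψ.sem u σ)
  | ite φ Φ₁ Φ₂ ih₁ ih₂ => simp [sem, ih₁, ih₂]
  | add Φ₁ Φ₂ ih₁ ih₂ => simp [sem, ih₁, ih₂]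
  | sum x Φ ih => simp [sem, ih]

/-- A weighted sentence is the semantics of the disjoint union of the automata of its monomials. -/
theorem exists_iUnion_usem_eq [Finite A] [Nonempty R] (Φ : WFO A R) :
    ∃ (n : ℕ) (ℬ : Fin n → WAut A R),
      (∀ i, (ℬ i).EventuallyAperiodic ∧ (ℬ i).SCCUnambiguous) ∧
      (Φ.SumFree → ∀ i, (ℬ i).Unambiguous) ∧ (WAut.iUnion ℬ).usem = Φ.usem := by
  obtain ⟨L, hL, hk⟩ := Monomial.exists_list_sem_eq Φ
  choose 𝒜 h𝒜 using fun m : Monomial A R => m.body.close.exists_wAut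
  refine ⟨L.length, fun i => 𝒜 (L.get i), fun i => ⟨(h𝒜 _).1, (h𝒜 _).2.1⟩,
    fun hs i => (h𝒜 _).2.2.1 ?_, ?_⟩
  · have hm := hk hs (L.get i) (List.get_mem _ _)
    generalize L.get i = m at hm
    obtain ⟨k, G⟩ := m
    obtain rfl : k = 0 := hm
    exact G.subsingleton_guard_close
  · funext u
    rw [WAut.usem_iUnion, usem, hL, ← Fin.sum_univ_fun_getElem]
    refine Finset.sum_congr rfl fun i _ => ?_
    rw [(h𝒜 _).2.2.2]
    exact GuardedProduct.sum_sem_close _ _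

/-- A weighted sentence without sums is the semantics of a single unambiguous automaton. -/
theorem exists_unambiguous_usem_eq [Finite A] [Nonempty R] (Φ : WFO A R) (h₁ : Φ.PlusFree)
    (h₂ : Φ.SumFree) :
    ∃ 𝒜 : WAut A R, 𝒜.Aperiodic ∧ 𝒜.SCCUnambiguous ∧ 𝒜.Unambiguous ∧ 𝒜.usem = Φ.usem := by
  obtain ⟨G, hG⟩ := GuardedProduct.exists_sem_eq Φ h₁ h₂
  let m := Monomial.ofGuarded G
  obtain ⟨𝒜, ha, hs, hu, h⟩ := m.body.close.exists_wAut
  refine ⟨𝒜, ha.aperiodic, hs, hu (GuardedProduct.subsingleton_guard_close (G.comap Sum.inl)), ?_⟩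
  funext u
  rw [h, usem, hG, ← Monomial.sem_ofGuarded]
  exact GuardedProduct.sum_sem_close _ _

end WFO

theorem theorem6p5 {A R : Type*} [Finite A] (Φ : WFO A R) (hΦ : Φ.IsSentence) :
    (∃ 𝒜 : WAut A R, 𝒜.Aperiodic ∧ 𝒜.SCCUnambiguous ∧ 𝒜.usem = Φ.usem) ∧
    (Φ.PlusFree → Φ.SumFree →
      ∃ 𝒜 : WAut A R, 𝒜.Aperiodic ∧ 𝒜.SCCUnambiguous ∧ 𝒜.Unambiguous ∧ 𝒜.usem = Φ.usem) ∧
    (Φ.SumFree →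
      ∃ (n : ℕ) (ℬ : Fin n → WAut A R),
        (∀ i, (ℬ i).Aperiodic ∧ (ℬ i).Unambiguous) ∧
        (WAut.iUnion ℬ).Aperiodic ∧ (WAut.iUnion ℬ).SCCUnambiguous ∧
        (WAut.iUnion ℬ).usem = Φ.usem) := by
  -- The general construction needs a default weight. Without weights the semantics is zero,
  -- realized by the union of no automata.
  rcases isEmpty_or_nonempty R with hR | hR
  · have h0 : Φ.usem = fun _ => 0 := funext fun u => Φ.sem_eq_zero_of_isEmpty _ _
    have ha (ℬ : Fin 0 → WAut A R) : (WAut.iUnion ℬ).Aperiodic :=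
      (WAut.EventuallyAperiodic.iUnion fun i => i.elim0).aperiodic
    have hs (ℬ : Fin 0 → WAut A R) : (WAut.iUnion ℬ).SCCUnambiguous :=
      WAut.SCCUnambiguous.iUnion fun i => i.elim0
    have hu (ℬ : Fin 0 → WAut A R) : (WAut.iUnion ℬ).usem = Φ.usem := by
      rw [h0]
      funext u
      simp [WAut.usem_iUnion]
    exact ⟨⟨_, ha Fin.elim0, hs _, hu _⟩,
      fun _ _ => ⟨_, ha Fin.elim0, hs _, fun _ _ _ hρ => hρ.elim fun p _ => p.1.elim0, hu _⟩,
      fun _ => ⟨0, Fin.elim0, fun i => i.elim0, ha _, hs _, hu _⟩⟩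
  · obtain ⟨n, ℬ, hℬ, hu, h⟩ := Φ.exists_iUnion_usem_eq
    have ha := (WAut.EventuallyAperiodic.iUnion fun i => (hℬ i).1).aperiodic
    have hs := WAut.SCCUnambiguous.iUnion fun i => (hℬ i).2
    exact ⟨⟨_, ha, hs, h⟩, Φ.exists_unambiguous_usem_eq,
      fun hsum => ⟨n, ℬ, fun i => ⟨(hℬ i).1.aperiodic, hu hsum i⟩, ha, hs, h⟩⟩
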